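/- Conventions. A dimension group is a partially ordered abelian group $G$ that is directed, unperforated ($n\ge 1$ and $nx\ge 0$ imply $x\ge 0$) and has the Riesz interpolation property. An order unit of $G$ is an element $u\ge 0$ such that every $x\in G$ satisfies $x\le nu$ for some $n\in\mathbf N$. For an order unit $u$, the trace space $S(G,u)$ is the convex set of positive group homomorphisms $\tau:G\to\mathbf R$ with $\tau(u)=1$; its extreme points are the pure traces of $(G,u)$. The pseudo-norm of $(G,u)$, coming from the affine representation $G\to\operatorname{Aff}S(G,u)$, $g\mapsto(\tau\mapsto\tau(g))$, is $\|g\|_u=\sup_{\tau\in S(G,u)}|\tau(g)|$. The infinitesimals of $G$ are $\operatorname{Inf}G=\{g\in G: -u\le ng\le u\text{ for all }n\in\mathbf Z\}$. A dimension group $(G,u)$ with order unit is approximately divisible if $\tau(G)$ is dense in $\mathbf R$ for every pure trace $\tau$. The rank of a torsion-free abelian group $J$ is $\dim_{\mathbf Q}(J\otimes_{\mathbf Z}\mathbf Q)$. Let $\mathcal H$ be the class of dimension groups $H$ that are direct limits (as partially ordered abelian groups, over a nonempty directed set) of positive group homomorphisms $\phi_{\alpha\beta}:G_\alpha\to G_\beta$,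 where each $G_\alpha$ is an approximately divisible dimension group with order unit $u_\alpha$ and with only finitely many pure traces, and each $\phi_{\alpha\beta}(u_\alpha)$ is an order unit of $G_\beta$. Each $H\in\mathcal H$ has an order unit. A dimension group $(R,v)$ with order unit is strongly anti-finite dimensional (Anti-FD) if for every $H\in\mathcal H$ and every order unit $u$ of $H$, every group homomorphism $\phi:H\to R$ that is continuous with respect to the pseudo-norms $\|\cdot\|_u$ and $\|\cdot\|_v$ is zero. Corollary 4.5. Let $(R,v)$ be an approximately divisible dimension group with order unit. Then $R$ is Anti-FD if and only if $\operatorname{Inf}R=0$ and every finite-rank subgroup of $R$ is discrete in the topology of the pseudo-norm $\|\cdot\|_v$. -/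

import Mathlib

universe u w

namespace DimGroup

/-! Partially ordered abelian groups are types with `AddCommGroup`, `PartialOrder` and
`IsOrderedAddMonoid` (translation invariance of the order). -/

section Basic

variable {G : Type*} [AddCommGroup G] [PartialOrder G]

/-- `a` is an order unit: it is positive, and every element lies below a multiple of it. -/
def IsOrderUnit (a : G) : Prop :=
  0 ≤ a ∧ ∀ x : G, ∃ n : ℕ, x ≤ n • a

variable (G) in
/-- A dimension group: a partially ordered abelian group that is directed, unperforated and
has the Riesz interpolation property. -/
structure IsDimensionGroup : Prop where
  directed : ∀ x y : G, ∃ z : G, x ≤ z ∧ y ≤ z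
  unperforated : ∀ (n : ℕ) (x : G), 0 < n → 0 ≤ n • x → 0 ≤ x
  interpolation : ∀ a₁ a₂ b₁ b₂ : G, a₁ ≤ b₁ → a₁ ≤ b₂ → a₂ ≤ b₁ → a₂ ≤ b₂ →
    ∃ c : G, a₁ ≤ c ∧ a₂ ≤ c ∧ c ≤ b₁ ∧ c ≤ b₂

/-- The trace space `S(G, a)`: positive additive maps to the reals sending `a` to `1`. -/
def traceSpace (a : G) : Set (G →+ ℝ) :=
  {τ | (∀ x : G, 0 ≤ x → 0 ≤ τ x) ∧ τ a = 1}

/-- The pure traces `∂ₑ S(G, a)`. -/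
def pureTraces (a : G) : Set (G →+ ℝ) :=
  (traceSpace a).extremePoints ℝ

/-- `(G, a)` is approximately divisible: every pure trace has dense range. -/
def IsApproxDivisible (a : G) : Prop :=
  ∀ τ ∈ pureTraces a, Dense (Set.range τ)

/-- The pseudo-norm of the affine representation `G → Aff S(G, a)`, `x ↦ (τ ↦ τ x)`:
the supremum norm of the image of `x` (the supremum is finite when `a` is an order unit). -/
noncomputable def traceNorm (a x : G) : ℝ :=
  ⨆ τ : traceSpace a, |(τ : G →+ ℝ) x|

/-- The infinitesimals `Inf G`, for an order unit `a`: the elements `x` with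
`-a ≤ n • x ≤ a` for all integers `n` (replace `n` by `-n` for the lower bound). -/
def infinitesimals (a : G) : Set G :=
  {x | ∀ n : ℤ, n • x ≤ a}

/-- The rank of an abelian group is finite. `Module.rank ℤ L` is the maximal size of a
`ℤ`-independent family, i.e. the dimension of `ℚ ⊗ L`. -/
def HasFiniteRank (L : AddSubgroup G) : Prop :=
  Module.rank ℤ L < Cardinal.aleph0

/-- The subgroup `L` is discrete in the topology of the pseudo-norm `traceNorm a`. -/
def IsDiscreteSubgroup (a : G) (L : AddSubgroup G) : Prop :=
  ∀ x ∈ L, ∃ ε : ℝ, 0 < ε ∧ ∀ y ∈ L, traceNorm a (y - x) < ε → y = x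

end Basic

/-- Continuity of a group homomorphism with respect to the pseudo-norms of the affine
representations of `(H, a)` and `(R, b)`. -/
def IsTraceContinuous {H R : Type*} [AddCommGroup H] [PartialOrder H]
    [AddCommGroup R] [PartialOrder R] (a : H) (b : R) (φ : H →+ R) : Prop :=
  ∀ x : H, ∀ ε : ℝ, 0 < ε → ∃ δ : ℝ, 0 < δ ∧
    ∀ y : H, traceNorm a (y - x) < δ → traceNorm b (φ y - φ x) < ε

/-- `H`, with the maps `ψ i : G i → H`, is the direct limit, in the category of partially
ordered abelian groups and positive homomorphisms, of the direct system `(G, f)`: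
`H` is the direct limit of the groups, and its positive cone is the union of the images of
the positive cones. -/
structure IsOrderedDirectLimit {ι : Type*} [Preorder ι] {G : ι → Type*}
    [∀ i, AddCommGroup (G i)] [∀ i, PartialOrder (G i)]
    {H : Type*} [AddCommGroup H] [PartialOrder H]
    (f : ∀ i j, i ≤ j → G i →+ G j) (ψ : ∀ i, G i →+ H) : Prop where
  map_nonneg : ∀ i j (h : i ≤ j) (x : G i), 0 ≤ x → 0 ≤ f i j h x
  map_self : ∀ i (x : G i), f i i le_rfl x = x
  map_map : ∀ i j k (hij : i ≤ j) (hjk : j ≤ k) (x : G i),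
    f j k hjk (f i j hij x) = f i k (hij.trans hjk) x
  compat : ∀ i j (h : i ≤ j) (x : G i), ψ j (f i j h x) = ψ i x
  exists_rep : ∀ y : H, ∃ i, ∃ x : G i, ψ i x = y
  eq_zero : ∀ i (x : G i), ψ i x = 0 → ∃ j, ∃ h : i ≤ j, f i j h x = 0
  nonneg_iff : ∀ y : H, 0 ≤ y ↔ ∃ i, ∃ x : G i, 0 ≤ x ∧ ψ i x = y

/-- Pro-finite dimensional dimension groups (the class `𝓗`): dimension groups that are direct
limits, over a directed set, of approximately divisible dimension groups with order unit and
finitely many pure traces, along positive homomorphisms sending the order units to order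
units. -/
def IsProFD (H : Type w) [AddCommGroup H] [PartialOrder H] : Prop :=
  IsDimensionGroup H ∧
  ∃ (ι : Type w) (_ : Preorder ι) (_ : IsDirectedOrder ι) (_ : Nonempty ι)
    (G : ι → Type w) (_ : ∀ i, AddCommGroup (G i)) (_ : ∀ i, PartialOrder (G i))
    (_ : ∀ i, IsOrderedAddMonoid (G i))
    (f : ∀ i j, i ≤ j → G i →+ G j) (ψ : ∀ i, G i →+ H) (e : ∀ i, G i),
    IsOrderedDirectLimit f ψ ∧
    (∀ i, IsDimensionGroup (G i) ∧ IsOrderUnit (e i) ∧ IsApproxDivisible (e i) ∧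
      (pureTraces (e i)).Finite) ∧
    ∀ i j (h : i ≤ j), IsOrderUnit (f i j h (e i))

/-- `(R, v)` is strongly anti-finite dimensional (Anti-FD): every continuous group
homomorphism from a group in `𝓗` to `R` is zero. The pseudo-norm on the source is taken with
respect to any of its order units `a`. The universe `w` of the sources is arbitrary. -/
def IsAntiFD (R : Type u) [AddCommGroup R] [PartialOrder R] (v : R) : Prop :=
  ∀ (H : Type w) [AddCommGroup H] [PartialOrder H] [IsOrderedAddMonoid H] (a : H),
    IsProFD H → IsOrderUnit a →
    ∀ φ : H →+ R, IsTraceContinuous a v φ → φ = 0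

end DimGroup

/-! Sufficiency. A group in `𝓗` is covered by images of groups `G` with finitely many pure traces,
and positive maps are bounded for the pseudo-norms, so a continuous `φ : G →+ R` is to be killed.
Let `h` be evaluation at the pure traces; by Krein–Milman the sup norm of `h` dominates the
pseudo-norm. On the preimage of a finite-rank subgroup of `R`, discreteness makes `φ` kill all
elements with small `h`. Diophantine approximation makes some `q • x` close to an integer
combination of a fixed finite family `b`, so `q • φ x` lies in the span of `φ ∘ b` and `φ` has
finite-rank range. Hence `φ` kills an entire `h`-ball around `0`, and compactness puts its range in
a finitely generated, hence free, group. If `φ ≠ 0`, a coordinate of it is a nonzero order-bounded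
map `G →+ ℤ`. Riesz decomposition turns that into a positive one, then into one on an extreme ray,
which is a pure trace with discrete range after scaling: a contradiction
(`IsDimensionGroup.hom_int_eq_zero`).

Necessity. A torsion-free group with a dense map to `κ → ℝ` (`κ` finite, nonempty), given the strict
order pulled back from the coordinates, is in `𝓗`: its pure traces are among the normalized
coordinates. So a homomorphism from it to `R` bounded by the coordinate norm is zero
(`IsAntiFD.eq_zero_of_denseRange`). A nonzero infinitesimal would give such a map from `ℚ × ℤ`; a
non-discrete finite-rank subgroup contains a copy of a dense subgroup of some `ℝ^d`, `d > 0`, whose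
inclusion is bounded. -/

namespace DimGroup

/-! ### Sublinear functions and Hahn–Banach for abelian groups -/

/-- A real function on an abelian group that is subadditive and homogeneous for the natural
numbers. -/
structure IsSublinear {G : Type*} [AddCommGroup G] (p : G → ℝ) : Prop where
  add_le : ∀ x y, p (x + y) ≤ p x + p y
  nsmul_le : ∀ (n : ℕ) x, n * p x ≤ p (n • x)

namespace IsSublinear

variable {G : Type*} [AddCommGroup G] {p : G → ℝ}

theorem map_zero (hp : IsSublinear p) : p 0 = 0 := by
  have h0 := hp.nsmul_le 0 0
  have h2 := hp.nsmul_le 2 0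
  simp at h0 h2
  linarith

theorem neg_map_neg_le (hp : IsSublinear p) (x : G) : -p (-x) ≤ p x := by
  have := hp.add_le x (-x)
  rw [add_neg_cancel, hp.map_zero] at this
  linarith

theorem map_nsmul_le (hp : IsSublinear p) (n : ℕ) (x : G) : p (n • x) ≤ n * p x := by
  induction n with
  | zero => simp [hp.map_zero]
  | succ k ih =>
    rw [succ_nsmul]
    have := hp.add_le (k • x) x
    push_cast
    linarith

/-- The largest sublinear function below `p` whose value at `-x` is at most `-p x`. -/
noncomputable def tilt (p : G → ℝ) (x y : G) : ℝ := ⨅ n : ℕ, (p (y + n • x) - n * p x)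

theorem tilt_bddBelow (hp : IsSublinear p) (x y : G) :
    BddBelow (Set.range fun n : ℕ => p (y + n • x) - n * p x) := by
  refine ⟨-p (-y), ?_⟩
  rintro _ ⟨n, rfl⟩
  have h1 := hp.add_le (y + n • x) (-y)
  have h2 := hp.nsmul_le n x
  rw [show y + n • x + -y = n • x by abel] at h1
  simp only
  linarith

theorem tilt_le (hp : IsSublinear p) (x y : G) (n : ℕ) :
    tilt p x y ≤ p (y + n • x) - n * p x :=
  ciInf_le (hp.tilt_bddBelow x y) n

theorem tilt_le_self (hp : IsSublinear p) (x y : G) : tilt p x y ≤ p y := by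
  simpa using hp.tilt_le x y 0

theorem tilt_neg_le (hp : IsSublinear p) (x : G) : tilt p x (-x) ≤ -p x := by
  have := hp.tilt_le x (-x) 1
  simpa [hp.map_zero] using this

theorem isSublinear_tilt (hp : IsSublinear p) (x : G) : IsSublinear (tilt p x) where
  add_le y z := by
    have key : ∀ n m : ℕ, tilt p x (y + z) ≤
        (p (y + n • x) - n * p x) + (p (z + m • x) - m * p x) := by
      intro n m
      have h1 := hp.tilt_le x (y + z) (n + m)
      have h2 := hp.add_le (y + n • x) (z + m • x)
      rw [show y + n • x + (z + m • x) = y + z + (n + m) • x by rw [add_nsmul]; abel] at h2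
      push_cast at h1
      linarith
    have h1 : ∀ n : ℕ, tilt p x (y + z) - (p (y + n • x) - n * p x) ≤ tilt p x z :=
      fun n => le_ciInf fun m => by linarith [key n m]
    have h2 : tilt p x (y + z) - tilt p x z ≤ tilt p x y :=
      le_ciInf fun n => by linarith [h1 n]
    linarith
  nsmul_le k y := by
    refine le_ciInf fun n => ?_
    rcases Nat.eq_zero_or_pos k with rfl | hk
    · have := hp.nsmul_le n x
      simp only [Nat.cast_zero, zero_mul, zero_smul, zero_add]
      linarith
    have h1 := hp.tilt_le x y n
    have h2 := hp.nsmul_le k (y + n • x)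
    -- Adding `(k - 1) n` further copies of `x` to `k • y + n • x` gives `k • (y + n • x)`. The case
    -- `k = 0` was split off because this natural subtraction would truncate.
    have h3 := hp.add_le (k • y + n • x) ((k * n - n) • x)
    have h4 := hp.map_nsmul_le (k * n - n) x
    have hle : n ≤ k * n := Nat.le_mul_of_pos_left n hk
    rw [show k • y + n • x + (k * n - n) • x = k • (y + n • x) by
      rw [add_assoc, ← add_nsmul, Nat.add_sub_cancel' hle, nsmul_add, mul_nsmul']] at h3
    rw [Nat.cast_sub hle, Nat.cast_mul] at h4
    have h5 : (k : ℝ) * tilt p x y ≤ k * (p (y + n • x) - n * p x) :=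
      mul_le_mul_of_nonneg_left h1 (Nat.cast_nonneg k)
    nlinarith

/-- Zorn's lemma: the pointwise infimum of a chain is finite, being at least `-p (-x)`, and is
subadditive because any two members can be replaced by the smaller one. -/
theorem exists_minimal_le (hp : IsSublinear p) :
    ∃ q : G → ℝ, IsSublinear q ∧ q ≤ p ∧ ∀ r : G → ℝ, IsSublinear r → r ≤ q → q ≤ r := by
  obtain ⟨m, hm⟩ := zorn_le₀ (α := (G → ℝ)ᵒᵈ)
    {q | IsSublinear (OrderDual.ofDual q) ∧ OrderDual.ofDual q ≤ p} (by
    intro c hc hchain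
    rcases c.eq_empty_or_nonempty with rfl | hne
    · exact ⟨OrderDual.toDual p, ⟨hp, le_rfl⟩, by simp⟩
    have : Nonempty c := hne.to_subtype
    have hbdd : ∀ x, BddBelow (Set.range fun q : c => OrderDual.ofDual q.1 x) := by
      intro x
      refine ⟨-p (-x), ?_⟩
      rintro _ ⟨q, rfl⟩
      have h1 := (hc q.2).1.neg_map_neg_le x
      have h2 := (hc q.2).2 (-x)
      simp only
      linarith
    let Q : G → ℝ := fun x => ⨅ q : c, OrderDual.ofDual q.1 x
    have hQ : ∀ (q : c) x, Q x ≤ OrderDual.ofDual q.1 x := fun q x => ciInf_le (hbdd x) q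
    refine ⟨OrderDual.toDual Q, ⟨⟨fun x y => ?_, fun n x => ?_⟩, ?_⟩, ?_⟩
    · have key : ∀ q r : c, Q (x + y) ≤ OrderDual.ofDual q.1 x + OrderDual.ofDual r.1 y := by
        intro q r
        rcases hchain.total q.2 r.2 with h | h
        · have h1 : OrderDual.ofDual r.1 x ≤ OrderDual.ofDual q.1 x := h x
          have h2 := (hc r.2).1.add_le x y
          linarith [hQ r (x + y)]
        · have h1 : OrderDual.ofDual q.1 y ≤ OrderDual.ofDual r.1 y := h y
          have h2 := (hc q.2).1.add_le x y
          linarith [hQ q (x + y)]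
      have h1 : ∀ q : c, Q (x + y) - OrderDual.ofDual q.1 x ≤ Q y :=
        fun q => le_ciInf fun r => by linarith [key q r]
      have h2 : Q (x + y) - Q y ≤ Q x := le_ciInf fun q => by linarith [h1 q]
      show Q (x + y) ≤ Q x + Q y
      linarith
    · show (n : ℝ) * Q x ≤ Q (n • x)
      exact le_ciInf fun q => (mul_le_mul_of_nonneg_left (hQ q x) (Nat.cast_nonneg n)).trans
        ((hc q.2).1.nsmul_le n x)
    · intro x
      obtain ⟨q, hq⟩ := hne
      exact (hQ ⟨q, hq⟩ x).trans ((hc hq).2 x)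
    · intro q hq x
      exact hQ ⟨q, hq⟩ x)
  exact ⟨OrderDual.ofDual m, hm.1.1, hm.1.2, fun r hr hrm =>
    hm.2 (y := OrderDual.toDual r) ⟨hr, hrm.trans hm.1.2⟩ hrm⟩

/-- Hahn–Banach for abelian groups. -/
theorem exists_addMonoidHom (hp : IsSublinear p) (x : G) :
    ∃ τ : G →+ ℝ, (∀ y, τ y ≤ p y) ∧ τ x = p x := by
  -- A minimal sublinear function lies below its own tilts, so it is odd, and hence additive.
  -- Starting from the tilt of `p` at `x` forces the value `p x` at `x`.
  obtain ⟨q, hq, hqp, hmin⟩ := (hp.isSublinear_tilt x).exists_minimal_le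
  have hodd : ∀ y, q (-y) ≤ -q y := fun y =>
    (hmin _ (hq.isSublinear_tilt y) (fun z => hq.tilt_le_self y z) (-y)).trans (hq.tilt_neg_le y)
  have hadd : ∀ y z, q (y + z) = q y + q z := by
    intro y z
    refine le_antisymm (hq.add_le y z) ?_
    have h1 := hq.neg_map_neg_le (y + z)
    have h2 := hq.add_le (-y) (-z)
    rw [← neg_add] at h2
    linarith [hodd y, hodd z]
  have hle : ∀ y, q y ≤ p y := fun y => (hqp y).trans (hp.tilt_le_self x y)
  refine ⟨AddMonoidHom.mk' q hadd, hle, le_antisymm (hle x) ?_⟩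
  have h1 : q (-x) ≤ -p x := (hqp (-x)).trans (hp.tilt_neg_le x)
  have h2 := hq.neg_map_neg_le x
  show p x ≤ q x
  linarith

end IsSublinear

/-! ### Traces, the pseudo-norm and infinitesimals -/

section Traces

variable {G : Type*} [AddCommGroup G] [PartialOrder G] {a : G}

theorem traceNorm_le {x : G} {C : ℝ} (hC : 0 ≤ C) (h : ∀ τ ∈ traceSpace a, |τ x| ≤ C) :
    traceNorm a x ≤ C :=
  Real.iSup_le (fun τ => h τ τ.2) hC

theorem traceNorm_nonneg (a x : G) : 0 ≤ traceNorm a x :=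
  Real.iSup_nonneg fun _ => abs_nonneg _

/-- The slopes `m / n` with `n • x ≤ m • a`. -/
def slopes (a x : G) : Set ℝ :=
  {r | ∃ (n : ℕ) (m : ℤ), 0 < n ∧ n • x ≤ m • a ∧ r = m / n}

theorem slopes_nonempty (ha : IsOrderUnit a) (x : G) : (slopes a x).Nonempty := by
  obtain ⟨n, hn⟩ := ha.2 x
  exact ⟨_, 1, n, one_pos, by simpa using hn, rfl⟩

variable [IsOrderedAddMonoid G]

theorem IsOrderUnit.exists_abs_le (ha : IsOrderUnit a) (x : G) :
    ∃ n : ℕ, x ≤ n • a ∧ -x ≤ n • a := by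
  obtain ⟨n, hn⟩ := ha.2 x
  obtain ⟨m, hm⟩ := ha.2 (-x)
  exact ⟨n + m, hn.trans (nsmul_le_nsmul_left ha.1 (Nat.le_add_right n m)),
    hm.trans (nsmul_le_nsmul_left ha.1 (Nat.le_add_left m n))⟩

theorem map_le_map_of_nonneg {τ : G →+ ℝ} (hτ : ∀ x, 0 ≤ x → 0 ≤ τ x) {x y : G}
    (h : x ≤ y) : τ x ≤ τ y := by
  have := hτ (y - x) (sub_nonneg.2 h)
  rw [map_sub] at this
  linarith

theorem abs_map_le_of_nonneg {τ : G →+ ℝ} (hτ : ∀ x, 0 ≤ x → 0 ≤ τ x) {x y : G}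
    (h : x ≤ y) (h' : -x ≤ y) : |τ x| ≤ τ y := by
  refine abs_le.2 ⟨?_, map_le_map_of_nonneg hτ h⟩
  have := map_le_map_of_nonneg hτ h'
  rw [map_neg] at this
  linarith

theorem IsOrderUnit.exists_forall_trace_abs_le (ha : IsOrderUnit a) (x : G) :
    ∃ n : ℕ, ∀ τ ∈ traceSpace a, |τ x| ≤ n := by
  obtain ⟨n, h1, h2⟩ := ha.exists_abs_le x
  refine ⟨n, fun τ hτ => ?_⟩
  have := abs_map_le_of_nonneg hτ.1 h1 h2
  simpa [hτ.2] using this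

theorem IsOrderUnit.bddAbove_trace (ha : IsOrderUnit a) (x : G) :
    BddAbove (Set.range fun τ : traceSpace a => |(τ : G →+ ℝ) x|) := by
  obtain ⟨n, hn⟩ := ha.exists_forall_trace_abs_le x
  refine ⟨n, ?_⟩
  rintro _ ⟨τ, rfl⟩
  exact hn τ τ.2

theorem IsOrderUnit.abs_le_traceNorm (ha : IsOrderUnit a) {τ : G →+ ℝ} (hτ : τ ∈ traceSpace a)
    (x : G) : |τ x| ≤ traceNorm a x :=
  le_ciSup (ha.bddAbove_trace x) ⟨τ, hτ⟩

/-- The affine representation of `(G, a)`, valued in the bounded functions on the trace space. -/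
noncomputable def traceRep (ha : IsOrderUnit a) :
    G →+ lp (fun _ : traceSpace a => ℝ) ⊤ where
  toFun x := ⟨fun τ => (τ : G →+ ℝ) x, memℓp_infty (by simpa using ha.bddAbove_trace x)⟩
  map_zero' := by ext τ; simp
  map_add' x y := Subtype.ext (funext fun τ => map_add (τ : G →+ ℝ) x y)

theorem norm_traceRep (ha : IsOrderUnit a) (x : G) : ‖traceRep ha x‖ = traceNorm a x := by
  rw [lp.norm_eq_ciSup]
  rfl

/-- A positive homomorphism bounded at the order units is bounded for the pseudo-norms. -/
theorem exists_traceNorm_map_le {H : Type*} [AddCommGroup H] [PartialOrder H]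
    [IsOrderedAddMonoid H] {b : H} (ha : IsOrderUnit a) (hb : IsOrderUnit b) (ψ : G →+ H)
    (hψ : ∀ x, 0 ≤ x → 0 ≤ ψ x) :
    ∃ K : ℝ, 0 < K ∧ ∀ x, traceNorm b (ψ x) ≤ K * traceNorm a x := by
  obtain ⟨n, hn⟩ := hb.2 (ψ a)
  refine ⟨n + 1, by positivity, fun x => traceNorm_le
    (mul_nonneg (by positivity) (traceNorm_nonneg _ _)) fun τ hτ => ?_⟩
  have hpos : ∀ x, 0 ≤ x → 0 ≤ (τ.comp ψ) x := fun x hx => hτ.1 _ (hψ x hx)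
  have hle : τ (ψ a) ≤ n := by simpa [hτ.2] using map_le_map_of_nonneg hτ.1 hn
  rcases (hpos a ha.1).eq_or_lt with h0 | h0
  -- If `τ ∘ ψ` vanishes at the order unit, it vanishes everywhere; otherwise it is a positive
  -- multiple of a trace.
  · obtain ⟨m, h1, h2⟩ := ha.exists_abs_le x
    have := abs_map_le_of_nonneg hpos h1 h2
    rw [map_nsmul, ← h0, smul_zero] at this
    exact this.trans (mul_nonneg (by positivity) (traceNorm_nonneg _ _))
  · replace h0 : 0 < τ (ψ a) := h0
    have hσ : (τ (ψ a))⁻¹ • τ.comp ψ ∈ traceSpace a := by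
      refine ⟨fun y hy => ?_, ?_⟩
      · exact mul_nonneg (inv_nonneg.2 h0.le) (hpos y hy)
      · exact inv_mul_cancel₀ h0.ne'
    have h1 : |(τ (ψ a))⁻¹ * τ (ψ x)| ≤ traceNorm a x := ha.abs_le_traceNorm hσ x
    rw [abs_mul, abs_of_pos (inv_pos.2 h0), inv_mul_le_iff₀ h0] at h1
    refine h1.trans (mul_le_mul_of_nonneg_right (by linarith) (traceNorm_nonneg _ _))

theorem IsOrderUnit.nonneg_of_zsmul_nonneg (ha : IsOrderUnit a) (h0 : a ≠ 0) {k : ℤ}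
    (hk : 0 ≤ k • a) : 0 ≤ k := by
  by_contra! hneg
  apply h0
  refine le_antisymm ?_ ha.1
  have h1 : (1 : ℤ) • a ≤ (-k) • a := zsmul_le_zsmul_left ha.1 (by omega)
  rw [one_zsmul, neg_zsmul] at h1
  exact h1.trans (neg_nonpos.2 hk)

theorem slopes_bddBelow (ha : IsOrderUnit a) (h0 : a ≠ 0) (x : G) : BddBelow (slopes a x) := by
  obtain ⟨N, hN⟩ := ha.2 (-x)
  refine ⟨-N, ?_⟩
  rintro _ ⟨n, m, hn, h, rfl⟩
  have h1 : n • -x ≤ n • N • a := nsmul_le_nsmul_right hN n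
  have h2 : 0 ≤ (m + n * N : ℤ) • a := by
    have := add_le_add h h1
    rw [smul_neg, add_neg_cancel] at this
    rwa [add_smul, mul_smul, natCast_zsmul, natCast_zsmul]
  have h3 := ha.nonneg_of_zsmul_nonneg h0 h2
  rw [le_div_iff₀ (by exact_mod_cast hn)]
  have : (0 : ℝ) ≤ m + n * N := by exact_mod_cast h3
  linarith

/-- This is the function fed to Hahn–Banach: every homomorphism below it is a trace of `(G, a)`. -/
theorem isSublinear_sInf_slopes (ha : IsOrderUnit a) (h0 : a ≠ 0) :
    IsSublinear fun x => sInf (slopes a x) where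
  add_le x y := by
    refine le_of_forall_pos_lt_add fun ε hε => ?_
    obtain ⟨_, ⟨n, m, hn, h, rfl⟩, h1⟩ :=
      exists_lt_of_csInf_lt (slopes_nonempty ha x) (lt_add_of_pos_right _ (half_pos hε))
    obtain ⟨_, ⟨n', m', hn', h', rfl⟩, h1'⟩ :=
      exists_lt_of_csInf_lt (slopes_nonempty ha y) (lt_add_of_pos_right _ (half_pos hε))
    have hmem : ((m : ℝ) / n + m' / n') ∈ slopes a (x + y) := by
      refine ⟨n * n', n' * m + n * m', Nat.mul_pos hn hn', ?_, ?_⟩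
      · have e1 := nsmul_le_nsmul_right h n'
        have e2 := nsmul_le_nsmul_right h' n
        have := add_le_add e1 e2
        rwa [smul_add, add_smul, mul_smul (n' : ℤ) m, mul_smul (n : ℤ) m', natCast_zsmul,
          natCast_zsmul, mul_smul n n' y, mul_comm n n', mul_smul n' n x]
      · have : (n : ℝ) ≠ 0 := by positivity
        have : (n' : ℝ) ≠ 0 := by positivity
        push_cast
        field_simp
    have := csInf_le (slopes_bddBelow ha h0 (x + y)) hmem
    linarith
  nsmul_le k x := by
    refine le_csInf (slopes_nonempty ha _) ?_
    rintro _ ⟨n, m, hn, h, rfl⟩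
    rcases Nat.eq_zero_or_pos k with rfl | hk
    · rw [zero_smul, smul_zero] at h
      have := ha.nonneg_of_zsmul_nonneg h0 h
      have : (0 : ℝ) ≤ m := by exact_mod_cast this
      simp only [Nat.cast_zero, zero_mul]
      positivity
    · have hmem : ((m : ℝ) / (n * k : ℕ)) ∈ slopes a x :=
        ⟨n * k, m, Nat.mul_pos hn hk, by rwa [mul_smul], rfl⟩
      have := csInf_le (slopes_bddBelow ha h0 x) hmem
      have hk' : (0 : ℝ) < k := by exact_mod_cast hk
      calc (k : ℝ) * sInf (slopes a x) ≤ k * (m / (n * k : ℕ)) :=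
            mul_le_mul_of_nonneg_left this hk'.le
        _ = m / n := by
            have : (n : ℝ) ≠ 0 := by positivity
            push_cast
            field_simp

/-- In an unperforated group with order unit, an element killed by all traces is
infinitesimal. -/
theorem mem_infinitesimals_of_traceNorm_eq_zero (ha : IsOrderUnit a)
    (hunp : ∀ (n : ℕ) (x : G), 0 < n → 0 ≤ n • x → 0 ≤ x) {x : G} (hx : traceNorm a x = 0) :
    x ∈ infinitesimals a := by
  by_cases h0 : a = 0
  · have hzero : ∀ y : G, y = 0 := fun y => by
      obtain ⟨n, h1, h2⟩ := ha.exists_abs_le y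
      rw [h0, smul_zero] at h1 h2
      exact le_antisymm h1 (neg_nonpos.1 h2)
    intro n
    rw [hzero (n • x), h0]
  have hp := isSublinear_sInf_slopes ha h0
  -- Some trace takes at `y` the infimum of the slopes, which is therefore `0`. A slope `m / n < 1`
  -- gives `n • y ≤ m • a ≤ n • a`, and unperforation finishes.
  have key : ∀ y : G, traceNorm a y = 0 → y ≤ a := by
    intro y hy
    obtain ⟨τ, hle, heq⟩ := hp.exists_addMonoidHom y
    have hτ : τ ∈ traceSpace a := by
      refine ⟨fun z hz => ?_, le_antisymm ?_ ?_⟩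
      · have h1 : (0 : ℝ) ∈ slopes a (-z) := ⟨1, 0, one_pos, by simpa using hz, by simp⟩
        have h2 := (hle (-z)).trans (csInf_le (slopes_bddBelow ha h0 _) h1)
        rw [map_neg] at h2
        linarith
      · have h1 : (1 : ℝ) ∈ slopes a a := ⟨1, 1, one_pos, by simp, by simp⟩
        exact (hle a).trans (csInf_le (slopes_bddBelow ha h0 _) h1)
      · have h1 : (-1 : ℝ) ∈ slopes a (-a) := ⟨1, -1, one_pos, by simp, by simp⟩
        have h2 := (hle (-a)).trans (csInf_le (slopes_bddBelow ha h0 _) h1)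
        rw [map_neg] at h2
        linarith
    have hτy : τ y = 0 := by
      have := ha.abs_le_traceNorm hτ y
      rw [hy] at this
      exact abs_nonpos_iff.1 this
    have hlt : sInf (slopes a y) < 1 := by
      have : sInf (slopes a y) = 0 := heq.symm.trans hτy
      linarith
    obtain ⟨_, ⟨n, m, hn, h, rfl⟩, h1⟩ := exists_lt_of_csInf_lt (slopes_nonempty ha y) hlt
    rw [div_lt_one (by exact_mod_cast hn)] at h1
    have hmn : m ≤ n := by exact_mod_cast h1.le
    refine sub_nonneg.1 (hunp n _ hn ?_)
    rw [smul_sub, sub_nonneg, ← natCast_zsmul a n]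
    exact h.trans (zsmul_le_zsmul_left ha.1 hmn)
  intro n
  apply key
  rw [← norm_traceRep ha] at hx ⊢
  rw [map_zsmul, norm_eq_zero.1 hx, smul_zero, norm_zero]

theorem traceNorm_eq_zero_of_mem_infinitesimals {x : G}
    (hx : x ∈ infinitesimals a) : traceNorm a x = 0 := by
  refine le_antisymm (traceNorm_le le_rfl fun τ hτ => ?_) (traceNorm_nonneg a x)
  refine abs_nonpos_iff.2 (not_not.1 fun hne => ?_)
  obtain ⟨n, hn⟩ := exists_nat_gt (1 / |τ x|)
  rw [div_lt_iff₀ (abs_pos.2 hne)] at hn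
  have h1 := map_le_map_of_nonneg hτ.1 (hx n)
  have h2 := map_le_map_of_nonneg hτ.1 (hx (-n))
  rw [map_zsmul, hτ.2] at h1 h2
  simp only [zsmul_eq_mul, Int.cast_natCast, Int.cast_neg] at h1 h2
  rcases abs_cases (τ x) with h | h <;> rw [h.1] at hn <;> linarith

theorem traceNorm_eq_zero_iff (ha : IsOrderUnit a)
    (hunp : ∀ (n : ℕ) (x : G), 0 < n → 0 ≤ n • x → 0 ≤ x) (hinf : infinitesimals a = {0})
    {x : G} : traceNorm a x = 0 ↔ x = 0 := by
  refine ⟨fun h => ?_, fun h => ?_⟩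
  · simpa [hinf] using mem_infinitesimals_of_traceNorm_eq_zero ha hunp h
  · exact traceNorm_eq_zero_of_mem_infinitesimals (by rw [hinf, h]; rfl)

theorem eq_zero_of_nsmul_eq_zero
    (hunp : ∀ (n : ℕ) (x : G), 0 < n → 0 ≤ n • x → 0 ≤ x) {n : ℕ} (hn : 0 < n) {x : G}
    (hx : n • x = 0) : x = 0 := by
  refine le_antisymm (neg_nonneg.1 (hunp n _ hn ?_)) (hunp n _ hn hx.ge)
  rw [smul_neg, hx, neg_zero]

end Traces

/-! ### Riesz decomposition and integer-valued homomorphisms -/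

section Riesz

variable {G : Type*} [AddCommGroup G] [PartialOrder G] [IsOrderedAddMonoid G]

/-- The first summand interpolates between `0, z - y` and `z, x`. -/
theorem IsDimensionGroup.exists_add_eq (hG : IsDimensionGroup G) {x y z : G} (hx : 0 ≤ x)
    (hy : 0 ≤ y) (hz : 0 ≤ z) (h : z ≤ x + y) :
    ∃ z₁ z₂, 0 ≤ z₁ ∧ z₁ ≤ x ∧ 0 ≤ z₂ ∧ z₂ ≤ y ∧ z₁ + z₂ = z := by
  obtain ⟨c, h1, h2, h3, h4⟩ := hG.interpolation 0 (z - y) z x hz hx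
    (sub_le_self z hy) (sub_le_iff_le_add.2 h)
  exact ⟨c, z - c, h1, h4, sub_nonneg.2 h3, sub_le_comm.1 h2, add_sub_cancel c z⟩

theorem IsDimensionGroup.exists_nonneg_sub (hG : IsDimensionGroup G) (x : G) :
    ∃ y z : G, 0 ≤ y ∧ 0 ≤ z ∧ x = y - z := by
  obtain ⟨y, hy, hx⟩ := hG.directed 0 x
  exact ⟨y, y - x, hy, sub_nonneg.2 hx, by abel⟩

theorem IsDimensionGroup.hom_ext (hG : IsDimensionGroup G) {A : Type*} [AddCommGroup A]
    {f g : G →+ A} (h : ∀ x, 0 ≤ x → f x = g x) : f = g := by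
  ext x
  obtain ⟨y, z, hy, hz, rfl⟩ := hG.exists_nonneg_sub x
  rw [map_sub, map_sub, h y hy, h z hz]

theorem IsDimensionGroup.exists_hom_of_additive (hG : IsDimensionGroup G) {A : Type*}
    [AddCommGroup A] (f : G → A) (hf : ∀ x y, 0 ≤ x → 0 ≤ y → f (x + y) = f x + f y) :
    ∃ F : G →+ A, ∀ x, 0 ≤ x → F x = f x := by
  choose P N hP hN hPN using hG.exists_nonneg_sub
  have key : ∀ x y z : G, 0 ≤ y → 0 ≤ z → x = y - z → f (P x) - f (N x) = f y - f z := by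
    intro x y z hy hz hx
    have h1 : P x + z = y + N x := by
      have := (hPN x).symm.trans hx
      rw [sub_eq_sub_iff_add_eq_add] at this
      exact this
    have h2 := congrArg f h1
    rw [hf _ _ (hP x) hz, hf _ _ hy (hN x)] at h2
    rw [sub_eq_sub_iff_add_eq_add]
    exact h2
  refine ⟨AddMonoidHom.mk' (fun x => f (P x) - f (N x)) fun x y => ?_, fun x hx => ?_⟩
  · rw [key (x + y) (P x + P y) (N x + N y) (add_nonneg (hP x) (hP y))
      (add_nonneg (hN x) (hN y)), hf _ _ (hP x) (hP y), hf _ _ (hN x) (hN y)]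
    · abel
    · nth_rewrite 1 [hPN x, hPN y]
      abel
  · have h0 : f 0 = 0 := by simpa using hf 0 0 le_rfl le_rfl
    show f (P x) - f (N x) = f x
    rw [key x x 0 hx le_rfl (by simp), h0, sub_zero]

/-- The supremum of an integer-valued homomorphism over the part of `[0, x]` in an ideal `I` is
again a homomorphism. -/
theorem IsDimensionGroup.exists_hom_isGreatest (hG : IsDimensionGroup G) (μ : G →+ ℤ)
    (I : Set G) (h0 : (0 : G) ∈ I) (hadd : ∀ x ∈ I, ∀ y ∈ I, x + y ∈ I)
    (hher : ∀ x ∈ I, ∀ y, 0 ≤ y → y ≤ x → y ∈ I)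
    (hbdd : ∀ x, ∃ B : ℤ, ∀ z, 0 ≤ z → z ≤ x → μ z ≤ B) :
    ∃ p : G →+ ℤ, ∀ x, 0 ≤ x → (∃ z ∈ I, 0 ≤ z ∧ z ≤ x ∧ μ z = p x) ∧
      ∀ z ∈ I, 0 ≤ z → z ≤ x → μ z ≤ p x := by
  have hex : ∀ x, ∃ k : ℤ, 0 ≤ x → (∃ z ∈ I, 0 ≤ z ∧ z ≤ x ∧ μ z = k) ∧
      ∀ z ∈ I, 0 ≤ z → z ≤ x → μ z ≤ k := by
    intro x
    by_cases hx : 0 ≤ x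
    · obtain ⟨B, hB⟩ := hbdd x
      obtain ⟨k, hk, hmax⟩ := Int.exists_greatest_of_bdd
        (P := fun k => ∃ z ∈ I, 0 ≤ z ∧ z ≤ x ∧ μ z = k)
        ⟨B, by rintro _ ⟨z, -, hz, hzx, rfl⟩; exact hB z hz hzx⟩ ⟨_, 0, h0, le_rfl, hx, rfl⟩
      exact ⟨k, fun _ => ⟨hk, fun z hz h1 h2 => hmax _ ⟨z, hz, h1, h2, rfl⟩⟩⟩
    · exact ⟨0, fun h => absurd h hx⟩
  choose f hf using hex
  obtain ⟨F, hF⟩ := hG.exists_hom_of_additive f (by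
    intro x y hx hy
    obtain ⟨⟨z, hz, hz0, hzx, hze⟩, hm⟩ := hf _ (add_nonneg hx hy)
    obtain ⟨⟨z₁, hz₁, hz₁0, hz₁x, hz₁e⟩, hm₁⟩ := hf _ hx
    obtain ⟨⟨z₂, hz₂, hz₂0, hz₂x, hz₂e⟩, hm₂⟩ := hf _ hy
    refine le_antisymm ?_ ?_
    -- One inequality splits a maximizer for `x + y` by Riesz decomposition; the other adds
    -- maximizers.
    · obtain ⟨w₁, w₂, a1, a2, a3, a4, rfl⟩ := hG.exists_add_eq hx hy hz0 hzx
      rw [← hze, map_add]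
      exact add_le_add
        (hm₁ _ (hher _ hz _ a1 (le_add_of_nonneg_right a3)) a1 a2)
        (hm₂ _ (hher _ hz _ a3 (le_add_of_nonneg_left a1)) a3 a4)
    · rw [← hz₁e, ← hz₂e, ← map_add]
      exact hm _ (hadd _ hz₁ _ hz₂) (add_nonneg hz₁0 hz₂0) (add_le_add hz₁x hz₂x))
  exact ⟨F, fun x hx => by rw [hF x hx]; exact hf x hx⟩

theorem map_le_map_of_nonneg_int {r : G →+ ℤ} (hr : ∀ x, 0 ≤ x → 0 ≤ r x) {x y : G}
    (h : x ≤ y) : r x ≤ r y := by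
  have := hr (y - x) (sub_nonneg.2 h)
  rw [map_sub] at this
  linarith

/-- A nonzero positive integer-valued homomorphism dominates a nonzero positive integer-valued
homomorphism that spans an extreme ray. -/
theorem IsDimensionGroup.exists_extreme_le (hG : IsDimensionGroup G) (p : G →+ ℤ)
    (hp : ∀ x, 0 ≤ x → 0 ≤ p x) {x : G} (hx : 0 ≤ x) (hpx : 0 < p x) :
    ∃ r : G →+ ℤ, (∀ y, 0 ≤ y → 0 ≤ r y) ∧ ∃ x₀, 0 ≤ x₀ ∧ 0 < r x₀ ∧
      ∀ (τ : G →+ ℝ) (C : ℝ), (∀ y, 0 ≤ y → 0 ≤ τ y) → (∀ y, 0 ≤ y → τ y ≤ C * r y) →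
        ∀ y, 0 ≤ y → (r x₀ : ℝ) * τ y = τ x₀ * r y := by
  classical
  have hex : ∃ n : ℕ, 0 < n ∧ ∃ x, 0 ≤ x ∧ p x = n :=
    ⟨(p x).toNat, by omega, x, hx, by omega⟩
  -- Choose `x₀` with the least positive value of `p`. Then `r`, the supremum of `p` over the ideal
  -- generated by `x₀`, agrees with `p` on the positive part of that ideal.
  obtain ⟨hm, x₀, hx₀, hpx₀⟩ := Nat.find_spec hex
  have hmin : ∀ y, 0 ≤ y → 0 < p y → p x₀ ≤ p y := by
    intro y hy hpy
    rw [hpx₀]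
    have := Nat.find_min' hex ⟨show 0 < (p y).toNat by omega, y, hy, by omega⟩
    omega
  obtain ⟨r, hr⟩ := hG.exists_hom_isGreatest p {z | ∃ n : ℕ, z ≤ n • x₀} ⟨0, by simp⟩
    (by
      rintro y ⟨n, hn⟩ z ⟨m, hm⟩
      exact ⟨n + m, by rw [add_nsmul]; exact add_le_add hn hm⟩)
    (by
      rintro y ⟨n, hn⟩ z - hz
      exact ⟨n, hz.trans hn⟩)
    (fun y => ⟨p y, fun z _ hzy => map_le_map_of_nonneg_int hp hzy⟩)
  have hrp : ∀ y, 0 ≤ y → ∀ n : ℕ, y ≤ n • x₀ → r y = p y := by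
    intro y hy n hn
    obtain ⟨⟨z, -, hz, hzy, h1⟩, h2⟩ := hr y hy
    exact le_antisymm (h1 ▸ map_le_map_of_nonneg_int hp hzy) (h2 y ⟨n, hn⟩ hy le_rfl)
  have hr0 : ∀ y, 0 ≤ y → 0 ≤ r y := by
    intro y hy
    have := (hr y hy).2 0 ⟨0, by simp⟩ le_rfl hy
    rwa [map_zero] at this
  have hrx₀ : r x₀ = p x₀ := hrp x₀ hx₀ 1 (by simp)
  refine ⟨r, hr0, x₀, hx₀, by omega, fun τ C hτ hC => ?_⟩
  have hzero : ∀ y, 0 ≤ y → r y = 0 → τ y = 0 := by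
    intro y hy h
    refine le_antisymm ?_ (hτ y hy)
    simpa [h] using hC y hy
  -- On `[0, x₀]` minimality leaves `r` only the values `0` and `r x₀`, and `τ` vanishes on positive
  -- elements where `r` does.
  have hbase : ∀ y, 0 ≤ y → y ≤ x₀ → (r x₀ : ℝ) * τ y = τ x₀ * r y := by
    intro y hy hyx
    have h1 := hrp y hy 1 (by simpa using hyx)
    rcases (hr0 y hy).eq_or_lt with h | h
    · rw [hzero y hy h.symm, ← h]
      simp
    · have h2 := hmin y hy (by omega)
      have h3 := map_le_map_of_nonneg_int hr0 hyx
      have h4 : r y = r x₀ := by omega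
      have h5 := hzero (x₀ - y) (sub_nonneg.2 hyx) (by rw [map_sub, h4, sub_self])
      rw [map_sub, sub_eq_zero] at h5
      rw [h4, h5, mul_comm]
  have hideal : ∀ n : ℕ, ∀ y, 0 ≤ y → y ≤ n • x₀ → (r x₀ : ℝ) * τ y = τ x₀ * r y := by
    intro n
    induction n with
    | zero =>
      intro y hy h
      rw [zero_smul] at h
      rw [le_antisymm h hy]
      simp
    | succ n ih =>
      intro y hy h
      rw [succ_nsmul] at h
      obtain ⟨y₁, y₂, a1, a2, a3, a4, rfl⟩ := hG.exists_add_eq (nsmul_nonneg hx₀ n) hx₀ hy h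
      have e1 := ih y₁ a1 a2
      have e2 := hbase y₂ a3 a4
      push_cast [map_add]
      linarith
  intro y hy
  -- A maximizer `z` in the ideal has `r (y - z) = 0`, hence `τ y = τ z`, which reduces to the
  -- ideal.
  obtain ⟨⟨z, ⟨n, hn⟩, hz, hzy, h1⟩, -⟩ := hr y hy
  have h2 : r z = r y := (hrp z hz n hn).trans h1
  have h3 := hzero (y - z) (sub_nonneg.2 hzy) (by rw [map_sub, h2, sub_self])
  rw [map_sub, sub_eq_zero] at h3
  rw [h3, ← h2]
  exact hideal n z hz hn

/-- Dividing an extreme integer-valued `r` by `r a` gives a pure trace with no value strictly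
between `0` and `1 / r a`. -/
theorem IsDimensionGroup.exists_pureTrace_not_dense (hG : IsDimensionGroup G) {a : G}
    (ha : IsOrderUnit a) (p : G →+ ℤ) (hp : ∀ x, 0 ≤ x → 0 ≤ p x) {x : G} (hx : 0 ≤ x)
    (hpx : 0 < p x) : ∃ τ ∈ pureTraces a, ¬ Dense (Set.range τ) := by
  obtain ⟨r, hr0, x₀, hx₀, hrx₀, hr⟩ := hG.exists_extreme_le p hp hx hpx
  have hra : 0 < r a := by
    obtain ⟨n, hn⟩ := ha.2 x₀
    have h1 := map_le_map_of_nonneg_int hr0 hn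
    rw [map_nsmul, nsmul_eq_mul] at h1
    by_contra! h
    nlinarith [hr0 a ha.1]
  have hra' : (0 : ℝ) < r a := by exact_mod_cast hra
  let σ : G →+ ℝ := (r a : ℝ)⁻¹ • (Int.castAddHom ℝ).comp r
  have hσ : ∀ y, σ y = (r a : ℝ)⁻¹ * r y := fun y => rfl
  refine ⟨σ, mem_extremePoints_iff_left.2 ⟨⟨fun y hy => ?_, ?_⟩, ?_⟩, fun hd => ?_⟩
  · have : (0 : ℝ) ≤ r y := by exact_mod_cast hr0 y hy
    rw [hσ]
    positivity
  · rw [hσ, inv_mul_cancel₀ hra'.ne']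
  · rintro τ₁ h₁ τ₂ h₂ ⟨s, t, hs, ht, -, hst⟩
    have h3 := hr τ₁ (s⁻¹ * (r a : ℝ)⁻¹) h₁.1 (by
      intro y hy
      have h4 : s * τ₁ y + t * τ₂ y = (r a : ℝ)⁻¹ * r y := DFunLike.congr_fun hst y
      have h5 := mul_nonneg ht.le (h₂.1 y hy)
      rw [mul_assoc, ← h4, le_inv_mul_iff₀ hs]
      linarith)
    have h4 := h3 a ha.1
    rw [h₁.2, mul_one] at h4
    refine hG.hom_ext fun y hy => ?_
    have h5 := h3 y hy
    have hrx₀' : (r x₀ : ℝ) ≠ 0 := by exact_mod_cast hrx₀.ne'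
    rw [hσ, eq_inv_mul_iff_mul_eq₀ hra'.ne']
    apply mul_left_cancel₀ hrx₀'
    calc (r x₀ : ℝ) * (r a * τ₁ y) = r a * (r x₀ * τ₁ y) := by ring
      _ = τ₁ x₀ * r a * r y := by rw [h5]; ring
      _ = r x₀ * r y := by rw [h4]
  · obtain ⟨_, ⟨y, rfl⟩, h1, h2⟩ := hd.exists_between (inv_pos.2 hra')
    rw [hσ] at h1 h2
    have h3 : (0 : ℝ) < r y := pos_of_mul_pos_right h1 (inv_pos.2 hra').le
    rw [inv_mul_lt_iff₀ hra', mul_inv_cancel₀ hra'.ne'] at h2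
    have h4 : 0 < r y := by exact_mod_cast h3
    have h5 : r y < 1 := by exact_mod_cast h2
    omega

/-- An approximately divisible dimension group has no nonzero order-bounded homomorphism to the
integers. -/
theorem IsDimensionGroup.hom_int_eq_zero (hG : IsDimensionGroup G) {a : G}
    (ha : IsOrderUnit a) (hdiv : IsApproxDivisible a) (μ : G →+ ℤ)
    (hbdd : ∀ x, ∃ B : ℤ, ∀ z, 0 ≤ z → z ≤ x → |μ z| ≤ B) : μ = 0 := by
  have key : ∀ ν : G →+ ℤ, (∀ x, ∃ B : ℤ, ∀ z, 0 ≤ z → z ≤ x → ν z ≤ B) →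
      ∀ x, 0 ≤ x → ν x ≤ 0 := by
    intro ν hν x hx
    by_contra! hpos
    -- The supremum of `ν` over `[0, y]` is positive in `y`, and at `x` it is at least `ν x > 0`.
    obtain ⟨p, hp⟩ := hG.exists_hom_isGreatest ν Set.univ trivial (fun _ _ _ _ => trivial)
      (fun _ _ _ _ _ => trivial) hν
    obtain ⟨τ, hτ, hnd⟩ := hG.exists_pureTrace_not_dense ha p
      (fun y hy => by simpa using (hp y hy).2 0 trivial le_rfl hy) hx
      (hpos.trans_le ((hp x hx).2 x trivial hx le_rfl))
    exact hnd (hdiv τ hτ)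
  refine hG.hom_ext fun x hx => le_antisymm (key μ (fun y => ?_) x hx) ?_
  · obtain ⟨B, hB⟩ := hbdd y
    exact ⟨B, fun z h1 h2 => (le_abs_self _).trans (hB z h1 h2)⟩
  · have := key (-μ) (fun y => ?_) x hx
    · simpa using this
    · obtain ⟨B, hB⟩ := hbdd y
      exact ⟨B, fun z h1 h2 => (neg_le_abs _).trans (hB z h1 h2)⟩

end Riesz

/-! ### Krein–Milman for the trace space -/

section KreinMilman

variable {G : Type*} [AddCommGroup G] [PartialOrder G] {a : G}

/-- Additive real functions as a subspace of all real functions. -/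
def evalLinear (G : Type*) [AddCommGroup G] : (G →+ ℝ) →ₗ[ℝ] (G → ℝ) where
  toFun τ := τ
  map_add' _ _ := rfl
  map_smul' _ _ := rfl

theorem evalLinear_injective (G : Type*) [AddCommGroup G] :
    Function.Injective (evalLinear G) := DFunLike.coe_injective

theorem convex_traceSpace (a : G) : Convex ℝ (traceSpace a) := by
  rintro τ hτ σ hσ s t hs ht hst
  refine ⟨fun x hx => ?_, ?_⟩
  · exact add_nonneg (mul_nonneg hs (hτ.1 x hx)) (mul_nonneg ht (hσ.1 x hx))
  · show s * τ a + t * σ a = 1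
    rw [hτ.2, hσ.2, mul_one, mul_one, hst]

theorem image_traceSpace (a : G) : evalLinear G '' traceSpace a =
    {f | (∀ x y, f (x + y) = f x + f y) ∧ (∀ x, 0 ≤ x → 0 ≤ f x) ∧ f a = 1} := by
  ext f
  constructor
  · rintro ⟨τ, hτ, rfl⟩
    exact ⟨map_add τ, hτ⟩
  · rintro ⟨h1, h2⟩
    exact ⟨AddMonoidHom.mk' f h1, h2, rfl⟩

/-- Tychonoff: the image is closed in a product of compact intervals. -/
theorem isCompact_image_traceSpace [IsOrderedAddMonoid G] (ha : IsOrderUnit a) :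
    IsCompact (evalLinear G '' traceSpace a) := by
  choose n hn using ha.exists_forall_trace_abs_le
  refine (isCompact_univ_pi fun x => isCompact_Icc (a := -(n x : ℝ)) (b := n x)).of_isClosed_subset
    ?_ ?_
  · rw [image_traceSpace]
    simp only [Set.ofPred_and, Set.ofPred_forall]
    refine IsClosed.inter ?_ (IsClosed.inter ?_ ?_)
    · exact isClosed_iInter fun x => isClosed_iInter fun y =>
        isClosed_eq (continuous_apply _) (by fun_prop)
    · exact isClosed_iInter fun x => isClosed_iInter fun _ =>
        isClosed_le continuous_const (continuous_apply _)
    · exact isClosed_eq (continuous_apply _) continuous_const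
  · rintro _ ⟨τ, hτ, rfl⟩ x -
    exact abs_le.1 (hn x τ hτ)

/-- The pseudo-norm is computed on the pure traces. -/
theorem traceNorm_le_of_pureTraces [IsOrderedAddMonoid G] (ha : IsOrderUnit a) {x : G} {C : ℝ}
    (hC : 0 ≤ C) (h : ∀ τ ∈ pureTraces a, |τ x| ≤ C) : traceNorm a x ≤ C := by
  have hconv : Convex ℝ (evalLinear G '' traceSpace a) :=
    (convex_traceSpace a).linear_image (evalLinear G)
  have hKM := closure_convexHull_extremePoints (isCompact_image_traceSpace ha) hconv
  have hsub : evalLinear G '' traceSpace a ⊆ {f | |f x| ≤ C} := by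
    rw [← hKM]
    refine closure_minimal (convexHull_min ?_ ?_) ?_
    · intro f hf
      obtain ⟨τ, hτ, rfl⟩ := hf.1
      refine h τ (mem_extremePoints_iff_left.2 ⟨hτ, fun τ₁ h₁ τ₂ h₂ hseg => ?_⟩)
      refine evalLinear_injective G ((mem_extremePoints_iff_left.1 hf).2 _ ⟨τ₁, h₁, rfl⟩ _
        ⟨τ₂, h₂, rfl⟩ ?_)
      obtain ⟨s, t, hs, ht, hst, e⟩ := hseg
      exact ⟨s, t, hs, ht, hst, by rw [← e, map_add, map_smul, map_smul]⟩
    · have : {f : G → ℝ | |f x| ≤ C} = LinearMap.proj (R := ℝ) (φ := fun _ : G => ℝ) x ⁻¹'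
          Set.Icc (-C) C := by
        ext f
        simp [abs_le]
      rw [this]
      exact (convex_Icc _ _).linear_preimage _
    · exact isClosed_le (continuous_apply x).abs continuous_const
  exact traceNorm_le hC fun τ hτ => hsub ⟨τ, hτ, rfl⟩

end KreinMilman

/-! ### Diophantine approximation in finite-dimensional spaces -/

section Approximation

variable {A E : Type*} [AddCommGroup A] [NormedAddCommGroup E] [NormedSpace ℝ E]

theorem exists_finite_basis_range [FiniteDimensional ℝ E] (h : A →+ E) : ∃ (n : ℕ) (b : Fin n → A),
    LinearIndependent ℝ (h ∘ b) ∧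
      Submodule.span ℝ (Set.range (h ∘ b)) = Submodule.span ℝ (Set.range h) := by
  obtain ⟨κ, b, -, hspan, hli⟩ := exists_linearIndependent' ℝ (h : A → E)
  have : Finite κ := hli.finite
  obtain ⟨n, ⟨e⟩⟩ := Finite.exists_equiv_fin κ
  refine ⟨n, b ∘ e.symm, ?_, ?_⟩
  · exact hli.comp _ e.symm.injective
  · rw [← hspan, ← Function.comp_assoc, e.symm.surjective.range_comp]

/-- Real coefficients are rounded down; each fractional part is below `1`. -/
theorem exists_int_combination_near {κ : Type*} [Fintype κ] (v : κ → E) {w : E}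
    (hw : w ∈ Submodule.span ℝ (Set.range v)) :
    ∃ c : κ → ℤ, ‖w - ∑ i, c i • v i‖ ≤ ∑ i, ‖v i‖ := by
  obtain ⟨r, rfl⟩ := (Submodule.mem_span_range_iff_exists_fun ℝ).1 hw
  refine ⟨fun i => ⌊r i⌋, ?_⟩
  rw [← Finset.sum_sub_distrib]
  refine (norm_sum_le _ _).trans (Finset.sum_le_sum fun i _ => ?_)
  rw [← Int.cast_smul_eq_zsmul ℝ, ← sub_smul, norm_smul, Int.self_sub_floor,
    Real.norm_of_nonneg (Int.fract_nonneg _)]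
  exact mul_le_of_le_one_left (norm_nonneg _) (Int.fract_lt_one _).le

theorem exists_bounded_sub {n : ℕ} (h : A →+ E) {b : Fin n → A}
    (hb : Submodule.span ℝ (Set.range (h ∘ b)) = Submodule.span ℝ (Set.range h)) :
    ∃ C : ℝ, ∀ x, ∃ c : Fin n → ℤ, ‖h (x - ∑ i, c i • b i)‖ ≤ C := by
  refine ⟨∑ i, ‖h (b i)‖, fun x => ?_⟩
  obtain ⟨c, hc⟩ := exists_int_combination_near (h ∘ b) (w := h x) (by
    rw [hb]
    exact Submodule.subset_span ⟨x, rfl⟩)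
  exact ⟨c, by simpa [map_sub, map_sum] using hc⟩

/-- The elements of sufficiently small norm span a subspace in which the group is dense. -/
theorem exists_dense_subspace [FiniteDimensional ℝ E] (h : A →+ E)
    (hnd : ∀ ε : ℝ, 0 < ε → ∃ y, h y ≠ 0 ∧ ‖h y‖ < ε) :
    ∃ F : Submodule ℝ E, 0 < Module.finrank ℝ F ∧
      ∀ w ∈ F, ∀ ε : ℝ, 0 < ε → ∃ y, h y ∈ F ∧ ‖w - h y‖ < ε := by
  classical
  let S : ℝ → Submodule ℝ E := fun ε => Submodule.span ℝ (h '' {y | ‖h y‖ < ε})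
  have hex : ∃ n : ℕ, ∃ ε : ℝ, 0 < ε ∧ Module.finrank ℝ (S ε) = n := ⟨_, 1, one_pos, rfl⟩
  -- The span of the elements of norm below `ε` shrinks with `ε`. At `ε₀` its dimension is minimal,
  -- so it is constant from there down.
  obtain ⟨ε₀, hε₀, hfr⟩ := Nat.find_spec hex
  have heq : ∀ ε : ℝ, 0 < ε → ε ≤ ε₀ → S ε = S ε₀ := by
    intro ε hε hle
    refine Submodule.eq_of_le_of_finrank_le
      (Submodule.span_mono (Set.image_mono fun y hy => lt_of_lt_of_le hy hle)) ?_
    rw [hfr]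
    exact Nat.find_min' hex ⟨ε, hε, rfl⟩
  refine ⟨S ε₀, ?_, fun w hw ε hε => ?_⟩
  · obtain ⟨y, hy0, hy⟩ := hnd ε₀ hε₀
    rw [Module.finrank_pos_iff_exists_ne_zero]
    exact ⟨⟨h y, Submodule.subset_span ⟨y, hy, rfl⟩⟩, fun h0 => hy0 (congrArg Subtype.val h0)⟩
  -- Rounding over a basis of `d - 1` vectors of norm below `ε / d` costs less than `ε`.
  · let d : ℝ := Module.finrank ℝ (S ε₀) + 1
    have hd : 0 < d := by positivity
    have hη : 0 < min ε₀ (ε / d) := lt_min hε₀ (div_pos hε hd)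
    have hS := heq _ hη (min_le_left _ _)
    obtain ⟨κ, b, -, hspan, hli⟩ :=
      exists_linearIndependent' ℝ (fun y : {y | ‖h y‖ < min ε₀ (ε / d)} => h y)
    rw [← Set.image_eq_range] at hspan
    change _ = S _ at hspan
    have : Finite κ := hli.finite
    have : Fintype κ := Fintype.ofFinite κ
    have hcard := finrank_span_eq_card hli
    rw [hspan, hS] at hcard
    rw [← hS, ← hspan] at hw
    obtain ⟨c, hc⟩ := exists_int_combination_near _ hw
    refine ⟨∑ i, c i • (b i : A), ?_, ?_⟩
    · rw [map_sum]
      refine Submodule.sum_mem _ fun i _ => ?_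
      rw [map_zsmul, ← Int.cast_smul_eq_zsmul ℝ]
      refine Submodule.smul_mem _ _ (Submodule.subset_span ⟨b i, ?_, rfl⟩)
      exact (show ‖h (b i)‖ < _ from (b i).2).trans_le (min_le_left _ _)
    · simp only [map_sum, map_zsmul]
      refine hc.trans_lt ?_
      have h1 : ∑ i, ‖h (b i)‖ ≤ ∑ _i : κ, ε / d :=
        Finset.sum_le_sum fun i _ => ((show ‖h (b i)‖ < _ from (b i).2).trans_le (min_le_right _ _)).le
      rw [Finset.sum_const, Finset.card_univ, ← hcard, nsmul_eq_mul] at h1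
      refine h1.trans_lt ?_
      rw [mul_div_assoc', div_lt_iff₀ hd, mul_comm]
      exact mul_lt_mul_of_pos_left (lt_add_one _) hε

theorem exists_finite_net [FiniteDimensional ℝ E] (h : A →+ E) (C : ℝ) {δ : ℝ} (hδ : 0 < δ) :
    ∃ t : Set A, t.Finite ∧ ∀ x, ‖h x‖ ≤ C → ∃ z ∈ t, ‖h (x - z)‖ < δ := by
  have htb : TotallyBounded (h '' {x | ‖h x‖ ≤ C}) := by
    have : ProperSpace E := FiniteDimensional.proper ℝ E
    refine (isCompact_closedBall (0 : E) C).totallyBounded.subset ?_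
    rintro _ ⟨x, hx, rfl⟩
    simpa using hx
  obtain ⟨t, ht, htf, hcov⟩ := Metric.finite_approx_of_totallyBounded htb δ hδ
  choose! g hg using fun y (hy : y ∈ t) => ht hy
  refine ⟨g '' t, htf.image g, fun x hx => ?_⟩
  obtain ⟨y, hy, hxy⟩ := Set.mem_iUnion₂.1 (hcov ⟨x, hx, rfl⟩)
  refine ⟨g y, ⟨y, hy, rfl⟩, ?_⟩
  rw [map_sub, (hg y hy).2, ← dist_eq_norm]
  exact hxy

/-- Simultaneous Diophantine approximation. -/
theorem exists_nsmul_sub_small [FiniteDimensional ℝ E] {n : ℕ} (h : A →+ E) {b : Fin n → A}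
    (hb : Submodule.span ℝ (Set.range (h ∘ b)) = Submodule.span ℝ (Set.range h)) (x : A)
    {δ : ℝ} (hδ : 0 < δ) :
    ∃ (q : ℕ) (c : Fin n → ℤ), 0 < q ∧ ‖h (q • x - ∑ i, c i • b i)‖ < δ := by
  obtain ⟨C, hC⟩ := exists_bounded_sub h hb
  choose c hc using fun k : ℕ => hC (k • x)
  obtain ⟨t, ht, hnet⟩ := exists_finite_net h C (half_pos hδ)
  choose z hz hzδ using fun k => hnet _ (hc k)
  have : Finite t := ht
  -- Pigeonhole: two multiples of `x`, reduced modulo `b` to a bounded region, are near the same net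
  -- point; their difference is small.
  obtain ⟨k, l, hkl, heq⟩ :=
    Finite.exists_ne_map_eq_of_infinite (fun k : ℕ => (⟨z k, hz k⟩ : t))
  have heq : z k = z l := congrArg Subtype.val heq
  wlog hlt : k < l generalizing k l
  · exact this l k hkl.symm (by simpa using heq.symm) heq.symm (by omega)
  refine ⟨l - k, fun i => c l i - c k i, by omega, ?_⟩
  have : (l - k) • x - ∑ i, (c l i - c k i) • b i =
      (l • x - ∑ i, c l i • b i - z l) - (k • x - ∑ i, c k i • b i - z k) := by
    simp only [sub_smul, Finset.sum_sub_distrib, heq, sub_nsmul x hlt.le]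
    abel
  rw [this, map_sub]
  calc _ ≤ _ := norm_sub_le _ _
    _ < δ / 2 + δ / 2 := add_lt_add (hzδ l) (hzδ k)
    _ = δ := add_halves δ

end Approximation

/-! ### Subgroups of finite rank -/

section FiniteRank

variable {R : Type*} [AddCommGroup R]

/-- The quotient of `L` by its part in `N` is torsion, so it has rank zero. -/
theorem hasFiniteRank_of_nsmul_mem (L : AddSubgroup R) {N : Submodule ℤ R} (hN : N.FG)
    (h : ∀ x ∈ L, ∃ q : ℕ, 0 < q ∧ q • x ∈ N) : HasFiniteRank L := by
  have : Module.Finite ℤ N := Module.Finite.iff_fg.2 hN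
  let N' : Submodule ℤ L := N.comap L.subtype.toIntLinearMap
  have h1 : Module.rank ℤ N' < Cardinal.aleph0 := by
    let f : N' →ₗ[ℤ] N := L.subtype.toIntLinearMap.restrict (fun x hx => hx)
    have hf : Function.Injective f := by
      intro x y hxy
      exact Subtype.ext (Subtype.ext (congrArg (fun z : N => (z : R)) hxy))
    exact (LinearMap.rank_le_of_injective f hf).trans_lt (Module.rank_lt_aleph0 ℤ N)
  have h2 : Module.rank ℤ (L ⧸ N') = 0 := by
    rw [rank_eq_zero_iff]
    intro x
    obtain ⟨y, rfl⟩ := Submodule.Quotient.mk_surjective N' x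
    obtain ⟨q, hq, hqy⟩ := h y y.2
    refine ⟨q, by omega, ?_⟩
    rw [← Submodule.Quotient.mk_smul, Submodule.Quotient.mk_eq_zero]
    show ((q : ℤ) • y : L).1 ∈ N
    rw [natCast_zsmul]
    exact hqy
  have h3 := rank_quotient_add_rank_of_isDomain N'
  rw [h2, zero_add] at h3
  exact h3.symm.trans_lt h1

theorem exists_int_basis_of_hasFiniteRank {L : AddSubgroup R} (hL : HasFiniteRank L) :
    ∃ s : Set R, s.Finite ∧ ∀ x ∈ L, ∃ q : ℤ, q ≠ 0 ∧ q • x ∈ Submodule.span ℤ s := by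
  obtain ⟨s, hs, hli⟩ := exists_set_linearIndependent_of_isDomain ℤ L
  have hsf : s.Finite := by
    rw [← Cardinal.lt_aleph0_iff_set_finite, hs]
    exact hL
  refine ⟨L.subtype '' s, hsf.image _, fun x hx => ?_⟩
  have h3 := rank_quotient_add_rank_of_isDomain (Submodule.span ℤ s)
  rw [rank_span_set hli, hs] at h3
  have h4 : Module.rank ℤ (L ⧸ Submodule.span ℤ s) = 0 :=
    
    Cardinal.eq_of_add_eq_add_right (h3.trans (zero_add _).symm) hL
  rw [rank_eq_zero_iff] at h4
  obtain ⟨q, hq, hqx⟩ := h4 (Submodule.Quotient.mk ⟨x, hx⟩)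
  refine ⟨q, hq, ?_⟩
  rw [← Submodule.Quotient.mk_smul, Submodule.Quotient.mk_eq_zero] at hqx
  have := Submodule.mem_map_of_mem (f := L.subtype.toIntLinearMap) hqx
  rw [Submodule.map_span] at this
  exact this

end FiniteRank

/-! ### Sufficiency: sources with finitely many pure traces -/

section FiniteDimensional

variable {G : Type*} [AddCommGroup G] [PartialOrder G] {a : G}

/-- Evaluation at the pure traces. -/
def pureRep (a : G) : G →+ (pureTraces a → ℝ) where
  toFun x τ := (τ : G →+ ℝ) x
  map_zero' := by ext; simp
  map_add' x y := by ext; simp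

variable [IsOrderedAddMonoid G]

theorem traceNorm_le_norm_pureRep [Fintype (pureTraces a)] (ha : IsOrderUnit a) (x : G) :
    traceNorm a x ≤ ‖pureRep a x‖ :=
  traceNorm_le_of_pureTraces ha (norm_nonneg _) fun τ hτ =>
    norm_le_pi_norm (pureRep a x) ⟨τ, hτ⟩

theorem norm_pureRep_mono [Fintype (pureTraces a)] {x y : G} (hx : 0 ≤ x) (hxy : x ≤ y) :
    ‖pureRep a x‖ ≤ ‖pureRep a y‖ := by
  refine (pi_norm_le_iff_of_nonneg (norm_nonneg _)).2 fun τ => ?_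
  refine le_trans ?_ (norm_le_pi_norm (pureRep a y) τ)
  have h0 := τ.2.1.1 x hx
  have h1 := map_le_map_of_nonneg τ.2.1.1 hxy
  show |τ.1 x| ≤ |τ.1 y|
  rwa [abs_of_nonneg h0, abs_of_nonneg (h0.trans h1)]

variable {R : Type*} [AddCommGroup R] [PartialOrder R] [IsOrderedAddMonoid R] {v : R}

theorem IsDimensionGroup.hom_eq_zero_of_finite_pureTraces (hG : IsDimensionGroup G)
    (ha : IsOrderUnit a) (hdiv : IsApproxDivisible a) (hfin : (pureTraces a).Finite)
    (hunp : ∀ (n : ℕ) (x : R), 0 < n → 0 ≤ n • x → 0 ≤ x)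
    (hdisc : ∀ L : AddSubgroup R, HasFiniteRank L → IsDiscreteSubgroup v L)
    (φ : G →+ R)
    (hφ : ∀ ε : ℝ, 0 < ε → ∃ δ : ℝ, 0 < δ ∧ ∀ y, traceNorm a y < δ → traceNorm v (φ y) < ε) :
    φ = 0 := by
  have : Fintype (pureTraces a) := hfin.fintype
  set h := pureRep a with hh
  have hsmall : ∀ L : AddSubgroup R, HasFiniteRank L →
      ∃ δ : ℝ, 0 < δ ∧ ∀ y, φ y ∈ L → ‖h y‖ < δ → φ y = 0 := by
    intro L hL
    obtain ⟨ε, hε, hε'⟩ := hdisc L hL 0 L.zero_mem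
    obtain ⟨δ, hδ, hδ'⟩ := hφ ε hε
    refine ⟨δ, hδ, fun y hy hyδ => hε' _ hy ?_⟩
    rw [sub_zero]
    exact hδ' y ((traceNorm_le_norm_pureRep ha y).trans_lt hyδ)
  obtain ⟨n, b, -, hb⟩ := exists_finite_basis_range h
  have hrank : HasFiniteRank φ.range := by
    refine hasFiniteRank_of_nsmul_mem _ (N := Submodule.span ℤ (Set.range (φ ∘ b)))
      (Submodule.fg_span (Set.finite_range _)) ?_
    rintro _ ⟨x, rfl⟩
    -- Finite rank of the range is not yet known, so discreteness is applied to a finitely generated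
    -- group depending on `x`, as does the resulting `δ`.
    let N := Submodule.span ℤ (insert (φ x) (Set.range (φ ∘ b)))
    have hbN : ∀ i, φ (b i) ∈ N := fun i =>
      Submodule.subset_span (Set.mem_insert_of_mem _ ⟨i, rfl⟩)
    obtain ⟨δ, hδ, hδ'⟩ := hsmall N.toAddSubgroup
      (hasFiniteRank_of_nsmul_mem _ (N := N)
        (Submodule.fg_span ((Set.finite_range _).insert _))
        fun y hy => ⟨1, one_pos, by rw [one_smul]; exact hy⟩)
    obtain ⟨q, c, hq, hqc⟩ := exists_nsmul_sub_small h hb x hδ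
    refine ⟨q, hq, ?_⟩
    have heq : φ (q • x - ∑ i, c i • b i) = q • φ x - ∑ i, c i • φ (b i) := by
      simp [map_sub, map_sum]
    have h0 := hδ' _ (by
      rw [heq]
      exact N.sub_mem (N.smul_of_tower_mem q (Submodule.subset_span (Set.mem_insert _ _)))
        (N.sum_mem fun i _ => N.smul_mem _ (hbN i))) hqc
    rw [heq, sub_eq_zero] at h0
    rw [h0]
    exact Submodule.sum_mem _ fun i _ => Submodule.smul_mem _ _ (Submodule.subset_span ⟨i, rfl⟩)
  obtain ⟨δ, hδ, hδ'⟩ := hsmall _ hrank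
  have hker : ∀ y, ‖h y‖ < δ → φ y = 0 := fun y hy => hδ' y ⟨y, rfl⟩ hy
  obtain ⟨C, hC⟩ := exists_bounded_sub h hb
  obtain ⟨t, ht, hnet⟩ := exists_finite_net h C hδ
  -- Modulo `b`, every element is within the now uniform `δ` of a point of the finite net `t`, so
  -- these finitely many values generate the range of `φ`.
  let N := Submodule.span ℤ (Set.range (φ ∘ b) ∪ φ '' t)
  have hφN : ∀ x, φ x ∈ N := by
    intro x
    obtain ⟨c, hc⟩ := hC x
    obtain ⟨z, hz, hzδ⟩ := hnet _ hc
    have h0 := hker _ hzδ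
    rw [map_sub, map_sub, sub_eq_zero, sub_eq_iff_eq_add, map_sum] at h0
    rw [h0]
    refine N.add_mem (Submodule.subset_span (Or.inr ⟨z, hz, rfl⟩)) (N.sum_mem fun i _ => ?_)
    rw [map_zsmul]
    exact N.smul_mem _ (Submodule.subset_span (Or.inl ⟨i, rfl⟩))
  have : Module.Finite ℤ N := Module.Finite.iff_fg.2
    (Submodule.fg_span ((Set.finite_range _).union (ht.image _)))
  have : IsAddTorsionFree R := ⟨fun n hn x y hxy => by
    refine sub_eq_zero.1 (eq_zero_of_nsmul_eq_zero hunp (Nat.pos_of_ne_zero hn) (x := x - y) ?_)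
    rw [smul_sub, sub_eq_zero]
    exact hxy⟩
  ext x
  by_contra hx
  have hx' : (⟨φ x, hφN x⟩ : N) ≠ 0 := fun h0 => hx (congrArg Subtype.val h0)
  -- `N` is finitely generated and torsion-free, hence free, so integer functionals separate its
  -- points.
  rw [Ne, ← Module.forall_dual_apply_eq_zero_iff ℤ, not_forall] at hx'
  obtain ⟨f, hf⟩ := hx'
  let μ : G →+ ℤ := f.toAddMonoidHom.comp (φ.codRestrict N.toAddSubgroup hφN)
  have hμ : ∀ y, ‖h y‖ < δ → μ y = 0 := by
    intro y hy
    have : (⟨φ y, hφN y⟩ : N) = 0 := Subtype.ext (hker y hy)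
    show f ⟨φ y, hφN y⟩ = 0
    rw [this, map_zero]
  refine hf (DFunLike.congr_fun (hG.hom_int_eq_zero ha hdiv μ fun y => ?_) x)
  -- The interval `[0, y]` is `h`-bounded and `μ` kills a `δ`-ball, so on it `μ` takes only values
  -- from a finite net.
  obtain ⟨t', ht', hnet'⟩ := exists_finite_net h ‖h y‖ hδ
  obtain ⟨B, hB⟩ := (ht'.image fun z => |μ z|).bddAbove
  refine ⟨B, fun z hz hzy => ?_⟩
  obtain ⟨z', hz', hzδ⟩ := hnet' z (norm_pureRep_mono hz hzy)
  have h0 := hμ _ hzδ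
  rw [map_sub, sub_eq_zero] at h0
  rw [h0]
  exact hB ⟨z', hz', rfl⟩

end FiniteDimensional

theorem isAntiFD_of_discrete {R : Type u} [AddCommGroup R] [PartialOrder R]
    [IsOrderedAddMonoid R] {v : R} (hR : IsDimensionGroup R)
    (hdisc : ∀ L : AddSubgroup R, HasFiniteRank L → IsDiscreteSubgroup v L) :
    IsAntiFD.{u, w} R v := by
  intro H _ _ _ a hH ha φ hφ
  obtain ⟨-, ι, _, _, _, G, _, _, _, f, ψ, e, hlim, hG, -⟩ := hH
  have key : ∀ i, φ.comp (ψ i) = 0 := by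
    intro i
    obtain ⟨hdim, hunit, hdiv, hfin⟩ := hG i
    have hψ : ∀ x, 0 ≤ x → 0 ≤ ψ i x := fun x hx => (hlim.nonneg_iff _).2 ⟨i, x, hx, rfl⟩
    obtain ⟨K, hK, hKle⟩ := exists_traceNorm_map_le hunit ha (ψ i) hψ
    refine hdim.hom_eq_zero_of_finite_pureTraces hunit hdiv hfin hR.unperforated hdisc _ ?_
    intro ε hε
    obtain ⟨δ, hδ, hδ'⟩ := hφ 0 ε hε
    refine ⟨δ / K, div_pos hδ hK, fun y hy => ?_⟩
    have := hδ' (ψ i y) (by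
      rw [sub_zero]
      refine (hKle y).trans_lt ?_
      rwa [lt_div_iff₀' hK] at hy)
    rwa [map_zero, sub_zero] at this
  ext y
  obtain ⟨i, x, rfl⟩ := hlim.exists_rep y
  exact DFunLike.congr_fun (key i) x


/-! ### Dimension groups from dense maps to coordinate spaces -/

/-- The strict order pulled back from a coordinate space along `h`. -/
@[reducible] def strictOrder {A κ : Type*} [AddCommGroup A] [Nonempty κ] (h : A →+ (κ → ℝ)) :
    PartialOrder A where
  le x y := x = y ∨ ∀ k, h x k < h y k
  le_refl x := Or.inl rfl
  le_trans x y z := by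
    rintro (rfl | hxy) (rfl | hyz)
    · exact Or.inl rfl
    · exact Or.inr hyz
    · exact Or.inr hxy
    · exact Or.inr fun k => (hxy k).trans (hyz k)
  le_antisymm x y := by
    rintro (rfl | hxy) (hyx | hyx)
    · rfl
    · rfl
    · exact hyx.symm
    -- With no coordinates, strict comparison would be vacuous and antisymmetry could fail.
    · obtain ⟨k⟩ := ‹Nonempty κ›
      exact absurd (hxy k) (hyx k).asymm

/-- The order of `A` is the strict order pulled back along `h`. -/
def IsStrictOrder {A κ : Type*} [AddCommGroup A] [PartialOrder A] (h : A →+ (κ → ℝ)) : Prop :=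
  ∀ x y, x ≤ y ↔ x = y ∨ ∀ k, h x k < h y k

theorem exists_map_between {A κ : Type*} [AddCommGroup A] [Finite κ] {h : A →+ (κ → ℝ)}
    (hd : DenseRange h) {f g : κ → ℝ} (hfg : ∀ k, f k < g k) :
    ∃ x, ∀ k, f k < h x k ∧ h x k < g k := by
  obtain ⟨x, hx⟩ := hd.exists_mem_open
    (isOpen_set_pi Set.finite_univ fun k _ => isOpen_Ioo (a := f k) (b := g k))
    (Set.univ_pi_nonempty_iff.2 fun k => Set.nonempty_Ioo.2 (hfg k))
  exact ⟨x, fun k => hx k trivial⟩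

/-- The normalized coordinate functionals. -/
noncomputable def coordTrace {A κ : Type*} [AddCommGroup A] (h : A →+ (κ → ℝ)) (a : A) (k : κ) : A →+ ℝ :=
  (h a k)⁻¹ • (Pi.evalAddMonoidHom (fun _ : κ => ℝ) k).comp h

theorem coordTrace_apply {A κ : Type*} [AddCommGroup A] (h : A →+ (κ → ℝ)) (a : A) (k : κ) (x : A) : coordTrace h a k x = (h a k)⁻¹ * h x k := rfl

namespace IsStrictOrder

variable {A κ : Type*} [AddCommGroup A] [PartialOrder A] {h : A →+ (κ → ℝ)}

theorem le_of_forall_lt (hle : IsStrictOrder h) {x y : A} (hxy : ∀ k, h x k < h y k) : x ≤ y :=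
  (hle x y).2 (Or.inr hxy)

theorem nonneg_of_forall_pos (hle : IsStrictOrder h) {x : A} (hx : ∀ k, 0 < h x k) : 0 ≤ x :=
  hle.le_of_forall_lt fun k => by simpa using hx k

theorem map_le (hle : IsStrictOrder h) {x y : A} (hxy : x ≤ y) (k : κ) : h x k ≤ h y k := by
  rcases (hle x y).1 hxy with rfl | hxy
  · exact le_rfl
  · exact (hxy k).le

theorem isOrderedAddMonoid (hle : IsStrictOrder h) : IsOrderedAddMonoid A where
  add_le_add_left x y hxy z := by
    rcases (hle x y).1 hxy with rfl | hxy
    · exact le_rfl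
    · exact hle.le_of_forall_lt fun k => by simpa using hxy k

/-- If one of the four comparisons is an equality, that element interpolates; otherwise density
supplies a point of the open box between the maxima and the minima. -/
theorem isDimensionGroup [Finite κ] (hle : IsStrictOrder h) (hd : DenseRange h)
    (htf : ∀ (n : ℕ) (x : A), 0 < n → n • x = 0 → x = 0) : IsDimensionGroup A where
  directed x y := by
    obtain ⟨z, hz⟩ := exists_map_between hd (f := fun k => max (h x k) (h y k))
      (g := fun k => max (h x k) (h y k) + 1) fun k => lt_add_one _
    exact ⟨z, hle.le_of_forall_lt fun k => (le_max_left _ _).trans_lt (hz k).1,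
      hle.le_of_forall_lt fun k => (le_max_right _ _).trans_lt (hz k).1⟩
  unperforated n x hn hx := by
    rcases (hle _ _).1 hx with hx | hx
    · exact (htf n x hn hx.symm).ge
    · refine hle.nonneg_of_forall_pos fun k => ?_
      have := hx k
      simp only [map_zero, Pi.zero_apply, map_nsmul, Pi.smul_apply, nsmul_eq_mul] at this
      exact pos_of_mul_pos_right this (Nat.cast_nonneg n)
  interpolation a₁ a₂ b₁ b₂ h11 h12 h21 h22 := by
    rcases (hle _ _).1 h11 with rfl | l11
    · exact ⟨a₁, le_rfl, h21, le_rfl, h12⟩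
    rcases (hle _ _).1 h12 with rfl | l12
    · exact ⟨a₁, le_rfl, h22, h11, le_rfl⟩
    rcases (hle _ _).1 h21 with rfl | l21
    · exact ⟨a₂, h11, le_rfl, le_rfl, h22⟩
    rcases (hle _ _).1 h22 with rfl | l22
    · exact ⟨a₂, h12, le_rfl, h21, le_rfl⟩
    obtain ⟨c, hc⟩ := exists_map_between hd (f := fun k => max (h a₁ k) (h a₂ k))
      (g := fun k => min (h b₁ k) (h b₂ k))
      fun k => max_lt (lt_min (l11 k) (l12 k)) (lt_min (l21 k) (l22 k))
    exact ⟨c, hle.le_of_forall_lt fun k => (le_max_left _ _).trans_lt (hc k).1,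
      hle.le_of_forall_lt fun k => (le_max_right _ _).trans_lt (hc k).1,
      hle.le_of_forall_lt fun k => (hc k).2.trans_le (min_le_left _ _),
      hle.le_of_forall_lt fun k => (hc k).2.trans_le (min_le_right _ _)⟩

variable {a : A}

theorem coordTrace_mem (hle : IsStrictOrder h) (ha : ∀ k, 0 < h a k) (k : κ) :
    coordTrace h a k ∈ traceSpace a := by
  refine ⟨fun x hx => ?_, inv_mul_cancel₀ (ha k).ne'⟩
  have := hle.map_le hx k
  rw [map_zero] at this
  exact mul_nonneg (inv_pos.2 (ha k)).le this

variable [Fintype κ]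

theorem isOrderUnit (hle : IsStrictOrder h) (ha : ∀ k, 0 < h a k) : IsOrderUnit a := by
  refine ⟨hle.nonneg_of_forall_pos ha, fun x => ?_⟩
  choose n hn using fun k => exists_nat_gt (h x k / h a k)
  refine ⟨∑ k, n k, hle.le_of_forall_lt fun k => ?_⟩
  have h1 := (div_lt_iff₀ (ha k)).1 (hn k)
  have h2 : n k ≤ ∑ k, n k := Finset.single_le_sum (fun _ _ => Nat.zero_le _) (Finset.mem_univ k)
  have h3 : (n k : ℝ) ≤ (∑ k, n k : ℕ) := by exact_mod_cast h2
  rw [map_nsmul, Pi.smul_apply, nsmul_eq_mul]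
  exact h1.trans_le (mul_le_mul_of_nonneg_right h3 (ha k).le)

theorem norm_le_traceNorm (hle : IsStrictOrder h) (ha : ∀ k, 0 < h a k) (x : A) :
    ‖h x‖ ≤ ‖h a‖ * traceNorm a x := by
  have := hle.isOrderedAddMonoid
  refine (pi_norm_le_iff_of_nonneg (mul_nonneg (norm_nonneg _) (traceNorm_nonneg _ _))).2
    fun k => ?_
  have h1 := (hle.isOrderUnit ha).abs_le_traceNorm (hle.coordTrace_mem ha k) x
  rw [coordTrace_apply, abs_mul, abs_of_pos (inv_pos.2 (ha k)), inv_mul_le_iff₀ (ha k)] at h1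
  refine h1.trans (mul_le_mul_of_nonneg_right ?_ (traceNorm_nonneg _ _))
  exact (le_abs_self _).trans (norm_le_pi_norm (h a) k)

/-- If `h x` is small, both `N • x` and `N • -x` lie below `a`, so `N * |τ x| ≤ 1`. -/
theorem trace_small (hle : IsStrictOrder h) (ha : ∀ k, 0 < h a k) {τ : A →+ ℝ}
    (hτ : τ ∈ traceSpace a) {ε : ℝ} (hε : 0 < ε) :
    ∃ δ : ℝ, 0 < δ ∧ ∀ x, ‖h x‖ < δ → |τ x| ≤ ε := by
  have := hle.isOrderedAddMonoid
  obtain ⟨c, hc, hca⟩ : ∃ c : ℝ, 0 < c ∧ ∀ k, c ≤ h a k := by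
    rcases isEmpty_or_nonempty κ with _ | _
    · exact ⟨1, one_pos, fun k => isEmptyElim k⟩
    · obtain ⟨k, hk⟩ := Finite.exists_min (h a)
      exact ⟨h a k, ha k, hk⟩
  obtain ⟨N, hN⟩ := exists_nat_gt (1 / ε)
  have hN0 : (0 : ℝ) < N := (one_div_pos.2 hε).trans hN
  refine ⟨c / N, div_pos hc hN0, fun x hx => ?_⟩
  have key : ∀ y, ‖h y‖ < c / N → N • y ≤ a := by
    intro y hy
    refine hle.le_of_forall_lt fun k => ?_
    rw [map_nsmul, Pi.smul_apply, nsmul_eq_mul]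
    have h1 := ((le_abs_self _).trans (norm_le_pi_norm (h y) k)).trans_lt hy
    rw [lt_div_iff₀' hN0] at h1
    exact h1.trans_le (hca k)
  have h1 := abs_map_le_of_nonneg hτ.1 (key x hx)
    (by rw [← smul_neg]; exact key (-x) (by rwa [map_neg, norm_neg]))
  rw [hτ.2, map_nsmul, nsmul_eq_mul, abs_mul, Nat.abs_cast] at h1
  rw [div_lt_iff₀ hε] at hN
  by_contra! hlt
  have := mul_lt_mul_of_pos_left hlt hN0
  linarith

/-- Let `T` agree with `τ` on a basis taken from the range of `h`. The difference `τ - T ∘ h` kills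
`b`, so at `x` it is `1 / q` times its value at `q • x - ∑ c i • b i`, which can be made arbitrarily
small. -/
theorem exists_linear_of_trace (hle : IsStrictOrder h) (ha : ∀ k, 0 < h a k) {τ : A →+ ℝ}
    (hτ : τ ∈ traceSpace a) : ∃ T : (κ → ℝ) →ₗ[ℝ] ℝ, ∀ x, τ x = T (h x) := by
  obtain ⟨n, b, hli, hb⟩ := exists_finite_basis_range h
  obtain ⟨T, hT⟩ := LinearMap.exists_extend ((Module.Basis.span hli).constr ℝ (τ ∘ b))
  have hTb : ∀ i, T (h (b i)) = τ (b i) := by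
    intro i
    have h1 := (Module.Basis.span hli).constr_basis ℝ (τ ∘ b) i
    rw [← hT] at h1
    simpa [Module.Basis.span_apply] using h1
  refine ⟨T, fun x => sub_eq_zero.1 (abs_nonpos_iff.1 (le_of_forall_pos_le_add fun ε hε => ?_))⟩
  rw [zero_add]
  obtain ⟨δ₁, hδ₁, h₁⟩ := hle.trace_small ha hτ (half_pos hε)
  obtain ⟨δ₂, hδ₂, h₂⟩ := Metric.continuousAt_iff.1
    ((LinearMap.continuous_of_finiteDimensional T).continuousAt : ContinuousAt T 0) (ε / 2)
    (half_pos hε)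
  obtain ⟨q, c, hq, hqc⟩ := exists_nsmul_sub_small h hb x (lt_min hδ₁ hδ₂)
  set y := q • x - ∑ i, c i • b i with hy
  have e1 := h₁ y (hqc.trans_le (min_le_left _ _))
  have e2 := h₂ (x := h y) (by rw [dist_zero_right]; exact hqc.trans_le (min_le_right _ _))
  rw [map_zero, dist_zero_right, Real.norm_eq_abs] at e2
  have e3 : τ y - T (h y) = q * (τ x - T (h x)) := by
    simp only [hy, map_sub, map_sum, map_nsmul, map_zsmul, hTb]
    rw [nsmul_eq_mul, nsmul_eq_mul]
    ring
  have e4 : |(q : ℝ) * (τ x - T (h x))| ≤ ε := by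
    rw [← e3]
    exact (abs_sub _ _).trans (by linarith)
  rw [abs_mul, Nat.abs_cast] at e4
  refine le_trans (le_mul_of_one_le_left (abs_nonneg _) ?_) e4
  exact_mod_cast hq

theorem exists_coeff_of_trace (hle : IsStrictOrder h) (hd : DenseRange h) (ha : ∀ k, 0 < h a k)
    {τ : A →+ ℝ} (hτ : τ ∈ traceSpace a) :
    ∃ t : κ → ℝ, (∀ k, 0 ≤ t k) ∧ ∀ x, τ x = ∑ k, h x k * t k := by
  classical
  obtain ⟨T, hT⟩ := hle.exists_linear_of_trace ha hτ
  have hpos : ∀ w : κ → ℝ, (∀ k, 0 < w k) → 0 ≤ T w := by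
    intro w hw
    have hopen : IsOpen (Set.univ.pi fun _ : κ => Set.Ioi (0 : ℝ)) :=
      isOpen_set_pi Set.finite_univ fun _ _ => isOpen_Ioi
    have hcl : IsClosed {w | 0 ≤ T w} :=
      isClosed_le continuous_const (LinearMap.continuous_of_finiteDimensional T)
    refine closure_minimal ?_ hcl (hd.open_subset_closure_inter hopen fun k _ => hw k)
    rintro _ ⟨hx, x, rfl⟩
    show 0 ≤ T (h x)
    rw [← hT]
    exact hτ.1 x (hle.nonneg_of_forall_pos fun k => hx k trivial)
  refine ⟨fun k => T fun j => if k = j then 1 else 0, fun k => ?_, fun x => ?_⟩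
  · refine le_of_forall_pos_le_add fun ε hε => ?_
    have h1 := hpos 1 fun _ => one_pos
    have h2 : 0 < T 1 + 1 := by linarith
    -- A basis vector is on the boundary of the orthant; this multiple of `1` moves it inside and
    -- changes `T` by at most `ε`.
    have h3 := hpos ((fun j => if k = j then 1 else 0) + (ε / (T 1 + 1)) • 1) fun j => by
      have : 0 < ε / (T 1 + 1) := div_pos hε h2
      simp only [Pi.add_apply, Pi.smul_apply, Pi.one_apply, smul_eq_mul, mul_one]
      split_ifs <;> linarith
    rw [map_add, map_smul, smul_eq_mul] at h3
    have h4 : ε / (T 1 + 1) * T 1 ≤ ε := by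
      rw [div_mul_eq_mul_div, div_le_iff₀ h2]
      exact mul_le_mul_of_nonneg_left (by linarith) hε.le
    linarith
  · rw [hT, LinearMap.pi_apply_eq_sum_univ T (h x)]
    rfl

/-- The trace space is the convex hull of the coordinate traces: the weights `h a k * t k` sum to `τ
a = 1`. -/
theorem pureTraces_subset (hle : IsStrictOrder h) (hd : DenseRange h) (ha : ∀ k, 0 < h a k) :
    pureTraces a ⊆ Set.range (coordTrace h a) := by
  have hS : traceSpace a = convexHull ℝ (Set.range (coordTrace h a)) := by
    refine Set.Subset.antisymm (fun τ hτ => ?_) (convexHull_min ?_ (convex_traceSpace a))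
    · obtain ⟨t, ht, hτt⟩ := hle.exists_coeff_of_trace hd ha hτ
      have hsum : τ = ∑ k, (h a k * t k) • coordTrace h a k := by
        ext x
        rw [hτt, AddMonoidHom.finsetSum_apply]
        refine Finset.sum_congr rfl fun k _ => ?_
        show h x k * t k = h a k * t k * ((h a k)⁻¹ * h x k)
        field_simp [(ha k).ne']
      rw [hsum]
      refine (convex_convexHull ℝ _).sum_mem (fun k _ => mul_nonneg (ha k).le (ht k)) ?_
        fun k _ => subset_convexHull ℝ _ ⟨k, rfl⟩
      rw [← hτt, hτ.2]
    · rintro _ ⟨k, rfl⟩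
      exact hle.coordTrace_mem ha k
  rw [pureTraces, hS]
  exact extremePoints_convexHull_subset

theorem isApproxDivisible (hle : IsStrictOrder h) (hd : DenseRange h) (ha : ∀ k, 0 < h a k) :
    IsApproxDivisible a := by
  intro τ hτ
  obtain ⟨k, rfl⟩ := hle.pureTraces_subset hd ha hτ
  have hsurj : Function.Surjective fun w : κ → ℝ => (h a k)⁻¹ * w k := fun r =>
    ⟨fun _ => h a k * r, inv_mul_cancel_left₀ (ha k).ne' r⟩
  exact hsurj.denseRange.comp hd (by fun_prop)

/-- The constant system over one point suffices. -/
theorem isProFD {A : Type w} [AddCommGroup A] [PartialOrder A] {h : A →+ (κ → ℝ)} {a : A}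
    (hle : IsStrictOrder h) (hd : DenseRange h)
    (htf : ∀ (n : ℕ) (x : A), 0 < n → n • x = 0 → x = 0) (ha : ∀ k, 0 < h a k) :
    IsProFD A := by
  refine ⟨hle.isDimensionGroup hd htf, PUnit, inferInstance, inferInstance, inferInstance,
    fun _ => A, fun _ => inferInstance, fun _ => inferInstance, fun _ => hle.isOrderedAddMonoid,
    fun _ _ _ => AddMonoidHom.id A, fun _ => AddMonoidHom.id A, fun _ => a, ?_, fun _ => ?_,
    fun _ _ _ => hle.isOrderUnit ha⟩
  · exact
      { map_nonneg := fun _ _ _ _ hx => hx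
        map_self := fun _ _ => rfl
        map_map := fun _ _ _ _ _ _ => rfl
        compat := fun _ _ _ _ => rfl
        exists_rep := fun y => ⟨⟨⟩, y, rfl⟩
        eq_zero := fun i x hx => ⟨i, le_rfl, hx⟩
        nonneg_iff := fun y => ⟨fun hy => ⟨⟨⟩, y, hy, rfl⟩, fun ⟨_, _, hx, e⟩ => e ▸ hx⟩ }
  · exact ⟨hle.isDimensionGroup hd htf, hle.isOrderUnit ha, hle.isApproxDivisible hd ha,
      (Set.finite_range _).subset (hle.pureTraces_subset hd ha)⟩

end IsStrictOrder

/-- Homomorphisms to an Anti-FD group vanish on groups densely mapped to a finite-dimensional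
space, if they are bounded for the norm of that space. -/
theorem IsAntiFD.eq_zero_of_denseRange {R : Type u} [AddCommGroup R] [PartialOrder R]
    [IsOrderedAddMonoid R] {v : R} (hR : IsAntiFD.{u, w} R v) {A : Type w} [AddCommGroup A]
    {κ : Type*} [Fintype κ] [Nonempty κ] (h : A →+ (κ → ℝ)) (hd : DenseRange h)
    (htf : ∀ (n : ℕ) (x : A), 0 < n → n • x = 0 → x = 0) (φ : A →+ R) (K : ℝ)
    (hφ : ∀ x, traceNorm v (φ x) ≤ K * ‖h x‖) : φ = 0 := by
  let _ : PartialOrder A := strictOrder h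
  have hle : IsStrictOrder h := fun _ _ => Iff.rfl
  have := hle.isOrderedAddMonoid
  obtain ⟨a, ha⟩ := exists_map_between hd (f := 0) (g := 1) fun _ => one_pos
  have ha' : ∀ k, 0 < h a k := fun k => (ha k).1
  refine hR A a (hle.isProFD hd htf ha') (hle.isOrderUnit ha') φ fun x ε hε => ?_
  have hc : 0 < |K| * ‖h a‖ + 1 := by positivity
  refine ⟨ε / (|K| * ‖h a‖ + 1), div_pos hε hc, fun y hy => ?_⟩
  rw [lt_div_iff₀' hc] at hy
  rw [← map_sub]
  have h0 := traceNorm_nonneg a (y - x)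
  calc traceNorm v (φ (y - x)) ≤ K * ‖h (y - x)‖ := hφ _
    _ ≤ |K| * ‖h (y - x)‖ := mul_le_mul_of_nonneg_right (le_abs_self K) (norm_nonneg _)
    _ ≤ |K| * (‖h a‖ * traceNorm a (y - x)) :=
        mul_le_mul_of_nonneg_left (hle.norm_le_traceNorm ha' _) (abs_nonneg K)
    _ ≤ (|K| * ‖h a‖ + 1) * traceNorm a (y - x) := by linarith
    _ < ε := hy


/-- A group mapped injectively and non-discretely to a finite-dimensional space contains a copy of
a dense subgroup of a coordinate space of positive dimension. -/
theorem exists_dense_coordinate_subgroup {L V : Type*} [AddCommGroup L] [NormedAddCommGroup V]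
    [NormedSpace ℝ V] [FiniteDimensional ℝ V] (h : L →+ V) (hinj : Function.Injective h)
    (hnd : ∀ ε : ℝ, 0 < ε → ∃ y, h y ≠ 0 ∧ ‖h y‖ < ε) :
    ∃ (d : ℕ) (D : AddSubgroup (Fin d → ℝ)) (g : D →+ L) (K : ℝ), 0 < d ∧
      Dense (D : Set (Fin d → ℝ)) ∧ Function.Injective g ∧ ∀ c, ‖h (g c)‖ ≤ K * ‖c‖ := by
  obtain ⟨F, hF, hdense⟩ := exists_dense_subspace h hnd
  let e : F ≃L[ℝ] (Fin (Module.finrank ℝ F) → ℝ) :=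
    ContinuousLinearEquiv.ofFinrankEq (by simp)
  -- `D` is the part of the range of `h` in `F`, read in coordinates; injectivity of `h` makes the
  -- lift `g` additive.
  let D : AddSubgroup (Fin (Module.finrank ℝ F) → ℝ) :=
    h.range.comap ((F.subtype.comp e.symm.toLinearEquiv.toLinearMap).toAddMonoidHom)
  have hD : ∀ c : D, ∃ y : L, h y = (e.symm (c : Fin (Module.finrank ℝ F) → ℝ) : V) := fun c => c.2
  choose g hg using hD
  refine ⟨_, D, AddMonoidHom.mk' g fun b c => hinj ?_,
    ‖(e.symm : (Fin (Module.finrank ℝ F) → ℝ) →L[ℝ] F)‖, hF, ?_, ?_, fun c => ?_⟩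
  · rw [map_add, hg, hg, hg, AddSubgroup.coe_add, map_add, Submodule.coe_add]
  · have h1 : DenseRange fun y : {y : L // h y ∈ F} => (⟨h y, y.2⟩ : F) := by
      intro w
      refine Metric.mem_closure_iff.2 fun ε hε => ?_
      obtain ⟨y, hy, hlt⟩ := hdense w w.2 ε hε
      refine ⟨_, ⟨⟨y, hy⟩, rfl⟩, ?_⟩
      rw [dist_eq_norm]
      exact hlt
    refine (e.surjective.denseRange.comp h1 e.continuous).mono ?_
    rintro _ ⟨y, rfl⟩
    refine ⟨y, ?_⟩
    show h y = (e.symm (e ⟨h y, y.2⟩) : V)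
    rw [e.symm_apply_apply]
  · intro b c hbc
    have h1 : (e.symm b : V) = e.symm c := by
      rw [← hg, ← hg]
      exact congrArg h hbc
    exact Subtype.ext (e.symm.injective (Subtype.ext h1))
  · show ‖h (g c)‖ ≤ _
    rw [hg]
    exact ContinuousLinearMap.le_opNorm (e.symm : (Fin (Module.finrank ℝ F) → ℝ) →L[ℝ] F) _

/-! ### Necessity -/

section AntiFD

variable {R : Type u} [AddCommGroup R] [PartialOrder R] [IsOrderedAddMonoid R] {v : R}

/-- Order `ℚ × ℤ` strictly by its first coordinate. For infinitesimal `x`, the map `(q, n) ↦ n • x`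
has image of pseudo-norm zero, so it vanishes, and its value at `(0, 1)` is `x`. -/
theorem IsAntiFD.infinitesimals_eq (hR : IsAntiFD.{u, w} R v) (hv : IsOrderUnit v) :
    infinitesimals v = {0} := by
  ext x
  refine ⟨fun hx => ?_, ?_⟩
  · let h : ULift.{w} (ℚ × ℤ) →+ (Unit → ℝ) :=
      { toFun := fun z _ => (z.down.1 : ℝ)
        map_zero' := by ext; simp
        map_add' := fun y z => by ext; simp }
    let φ : ULift.{w} (ℚ × ℤ) →+ R :=
      { toFun := fun z => z.down.2 • x
        map_zero' := by simp
        map_add' := fun y z => by simp [add_smul] }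
    have hd : DenseRange h := by
      have h1 : DenseRange fun z : ULift.{w} (ℚ × ℤ) => (z.down.1 : ℝ) := by
        refine Rat.denseRange_cast.comp
          (f := fun z : ULift.{w} (ℚ × ℤ) => z.down.1) ?_ Rat.continuous_coe_real
        exact Function.Surjective.denseRange fun q => ⟨⟨q, 0⟩, rfl⟩
      have h2 : Function.Surjective fun (r : ℝ) (_ : Unit) => r := fun f => ⟨f (), rfl⟩
      exact h2.denseRange.comp h1 (by fun_prop)
    have htf : ∀ (n : ℕ) (z : ULift.{w} (ℚ × ℤ)), 0 < n → n • z = 0 → z = 0 := by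
      intro n z hn hz
      have h1 : n • z.down.1 = 0 := congrArg (fun y => y.down.1) hz
      have h2 : n • z.down.2 = 0 := congrArg (fun y => y.down.2) hz
      exact ULift.ext _ _ (Prod.ext ((smul_eq_zero.1 h1).resolve_left hn.ne')
        ((smul_eq_zero.1 h2).resolve_left hn.ne'))
    have h0 := IsAntiFD.eq_zero_of_denseRange hR h hd htf φ 0 fun z => by
      rw [zero_mul]
      change traceNorm v (z.down.2 • x) ≤ 0
      rw [← norm_traceRep hv, map_zsmul, norm_eq_zero.1
        ((norm_traceRep hv x).trans (traceNorm_eq_zero_of_mem_infinitesimals hx)), smul_zero,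
        norm_zero]
    have h1 : φ ⟨(0, 1)⟩ = x := one_zsmul x
    rw [h0] at h1
    exact h1.symm
  · rintro rfl n
    rw [smul_zero]
    exact hv.1

/-- The image of a finite-rank subgroup under the affine representation spans a
finite-dimensional space. -/
theorem finiteDimensional_span_traceRep (hv : IsOrderUnit v) {L : AddSubgroup R}
    (hL : HasFiniteRank L) :
    FiniteDimensional ℝ (Submodule.span ℝ (Set.range ((traceRep hv).comp L.subtype))) := by
  obtain ⟨s, hs, hsL⟩ := exists_int_basis_of_hasFiniteRank hL
  have := FiniteDimensional.span_of_finite ℝ (hs.image (traceRep hv))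
  refine Submodule.finiteDimensional_of_le (S₂ := Submodule.span ℝ (traceRep hv '' s))
    (Submodule.span_le.2 ?_)
  rintro _ ⟨x, rfl⟩
  obtain ⟨q, hq, hqx⟩ := hsL x x.2
  have h1 : ∀ y ∈ Submodule.span ℤ s, traceRep hv y ∈ Submodule.span ℝ (traceRep hv '' s) := by
    intro y hy
    induction hy using Submodule.span_induction with
    | mem y hy => exact Submodule.subset_span ⟨y, hy, rfl⟩
    | zero => rw [map_zero]; exact Submodule.zero_mem _
    | add y z _ _ hy hz => rw [map_add]; exact Submodule.add_mem _ hy hz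
    | smul n y _ hy =>
      rw [map_zsmul, ← Int.cast_smul_eq_zsmul ℝ]
      exact Submodule.smul_mem _ _ hy
  have h2 := h1 _ hqx
  rw [map_zsmul, ← Int.cast_smul_eq_zsmul ℝ] at h2
  exact (Submodule.smul_mem_iff _ (by exact_mod_cast hq)).1 h2

/-- With no infinitesimals, `L` embeds isometrically in a finite-dimensional space. If it is not
discrete, it receives a bounded injection from a dense subgroup of some `ℝ^d`, `d > 0`, which
Anti-FD forces to be zero. -/
theorem IsAntiFD.isDiscreteSubgroup (hR : IsAntiFD.{u, w} R v) (hdim : IsDimensionGroup R)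
    (hv : IsOrderUnit v) {L : AddSubgroup R} (hL : HasFiniteRank L) :
    IsDiscreteSubgroup v L := by
  by_contra hnd
  have hnorm : ∀ x : R, traceNorm v x = 0 → x = 0 := fun x =>
    (traceNorm_eq_zero_iff hv hdim.unperforated (hR.infinitesimals_eq hv)).1
  set V := Submodule.span ℝ (Set.range ((traceRep hv).comp L.subtype)) with hV
  have : FiniteDimensional ℝ V := finiteDimensional_span_traceRep hv hL
  let h : L →+ V := ((traceRep hv).comp L.subtype).codRestrict V.toAddSubgroup
    fun x => Submodule.subset_span ⟨x, rfl⟩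
  have hhnorm : ∀ y : L, ‖h y‖ = traceNorm v (y : R) := fun y => norm_traceRep hv y
  have hinj : Function.Injective h := by
    refine (injective_iff_map_eq_zero h).2 fun y hy => Subtype.ext (hnorm _ ?_)
    rw [← hhnorm, hy, norm_zero]
  obtain ⟨d, D, g, K, hd, hdense, hginj, hK⟩ := exists_dense_coordinate_subgroup h hinj (by
    simp only [IsDiscreteSubgroup, not_forall, not_exists, not_and] at hnd
    obtain ⟨x, hx, hnd⟩ := hnd
    intro ε hε
    obtain ⟨y, hy, hlt, hne⟩ := hnd ε hε
    have hne' : (⟨y, hy⟩ - ⟨x, hx⟩ : L) ≠ 0 := fun h0 =>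
      hne (congrArg Subtype.val (sub_eq_zero.1 h0))
    exact ⟨⟨y, hy⟩ - ⟨x, hx⟩, (map_ne_zero_iff h hinj).2 hne', (hhnorm _).trans_lt hlt⟩)
  let k : ULift.{w} D →+ (Fin d → ℝ) := D.subtype.comp AddEquiv.ulift.toAddMonoidHom
  have hk : Function.Injective k := Subtype.val_injective.comp ULift.down_injective
  have hkd : DenseRange k := by
    refine hdense.mono fun c hc => ⟨⟨⟨c, hc⟩⟩, rfl⟩
  have : Nonempty (Fin d) := ⟨⟨0, hd⟩⟩
  have h0 := IsAntiFD.eq_zero_of_denseRange hR k hkd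
    (fun n z hn hz => hk (by
      have h1 := congrArg k hz
      rw [map_nsmul, map_zero, smul_eq_zero] at h1
      rw [h1.resolve_left hn.ne', map_zero]))
    (L.subtype.comp (g.comp AddEquiv.ulift.toAddMonoidHom)) K
    fun c => (hhnorm (g c.down)).symm.trans_le (hK c.down)
  -- An element with all coordinates positive is nonzero, yet the injection kills it.
  obtain ⟨c, hc⟩ := exists_map_between hkd (f := 0) (g := 1) fun _ => one_pos
  have h1 : g c.down = 0 := Subtype.ext (DFunLike.congr_fun h0 c)
  have h2 : c = 0 := ULift.down_injective (hginj (h1.trans (map_zero g).symm))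
  have h3 := (hc ⟨0, hd⟩).1
  rw [h2, map_zero] at h3
  exact lt_irrefl _ h3

end AntiFD
end DimGroup

theorem corollary4p5 {R : Type u} [AddCommGroup R] [PartialOrder R] [IsOrderedAddMonoid R]
    (v : R) (hR : DimGroup.IsDimensionGroup R) (hv : DimGroup.IsOrderUnit v)
    (hdiv : DimGroup.IsApproxDivisible v) :
    DimGroup.IsAntiFD.{u, w} R v ↔
      DimGroup.infinitesimals v = {0} ∧
      ∀ L : AddSubgroup R, DimGroup.HasFiniteRank L → DimGroup.IsDiscreteSubgroup v L :=
  ⟨fun h => ⟨h.infinitesimals_eq hv, fun _ hL => h.isDiscreteSubgroup hR hv hL⟩,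
    fun h => DimGroup.isAntiFD_of_discrete hR h.2⟩
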